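/- Work over $\mathbb{C}$. A rational normal curve in $\mathbb{P}^n$ is a linearly normal embedding of $\mathbb{P}^1$ of degree $n$, that is, the image of a map $\mathbb{P}^1\to\mathbb{P}^n$ given by a basis of the binary forms of degree $n$. A linear space $\Lambda\subset\mathbb{P}^n$ of codimension two is $(n-1)$-secant to a rational normal curve $\mathcal{C}$ if $\Lambda\cap\mathcal{C}$ consists of exactly $n-1$ distinct points. A property holds for $p$ points and $l$ codimension-two linear spaces in generic position if it holds on a nonempty Zariski open subset of the data space $(\mathbb{P}^n)^p\times G(n-2,\mathbb{P}^n)^l$. Let $n\ge 3$, $p\ge 1$ and $l\ge 0$ be integers with $p+l=n+3$. Then: (a) for $p$ points and $l$ codimension-two linear spaces of $\mathbb{P}^n$ in generic position there exists a unique rational normal curve passing through all the points and $(n-1)$-secant to all the linear spaces if and only if $$(p,l)\in\{(n+3,0),\ (n+2,1),\ (3,n),\ (2,n+1),\ (1,n+2)\};$$ (b) in the other cases, that is, if $p\ge 4$ and $l\ge 2$, for $p$ points and $l$ codimension-two linear spaces in generic position no such curve exists. -/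

import Mathlib

open scoped LinearAlgebra.Projectivization

/-- Complex projective space `ℙⁿ`: the lines through the origin of `ℂⁿ⁺¹`. -/
abbrev PSpace (n : ℕ) : Type := ℙ ℂ (Fin (n + 1) → ℂ)

/-- A rational normal curve in `ℙⁿ`: a linearly normal embedding of `ℙ¹` of degree `n`, that is,
the image of `ℙ¹` under a map `[a₀ : a₁] ↦ [f₀(a) : ⋯ : fₙ(a)]`, where the `n + 1` binary forms `fᵢ`
of degree `n` are linearly independent (so they are a basis of the complete linear system
`H⁰(ℙ¹, 𝒪(n))`, and they have no common zero on `ℙ¹`). -/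
def IsRationalNormalCurve (n : ℕ) (C : Set (PSpace n)) : Prop :=
  ∃ f : Fin (n + 1) → MvPolynomial (Fin 2) ℂ,
    (∀ i, (f i).IsHomogeneous n) ∧ LinearIndependent ℂ f ∧
    C = {P | ∃ a : Fin 2 → ℂ, a ≠ 0 ∧
          ∃ h : (fun i => MvPolynomial.eval a (f i)) ≠ 0,
            P = Projectivization.mk ℂ (fun i => MvPolynomial.eval a (f i)) h}

/-- A linear subspace of `ℙⁿ` of codimension two, given by its affine cone: a linear subspace
of `ℂⁿ⁺¹` of codimension two. -/
abbrev CodimTwoSpace (n : ℕ) : Type :=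
  {W : Submodule ℂ (Fin (n + 1) → ℂ) // Module.finrank ℂ ((Fin (n + 1) → ℂ) ⧸ W) = 2}

/-- The set of points of `ℙⁿ` on a codimension two linear space. -/
def CodimTwoSpace.pts {n : ℕ} (L : CodimTwoSpace n) : Set (PSpace n) :=
  {P | P.submodule ≤ L.1}

/-- `L` and `C` are `(n - 1)`-secant: they meet in exactly `n - 1` distinct points.
(For `n ≥ 2`, a nonzero `ncard` includes finiteness.) -/
def IsSecant {n : ℕ} (L : CodimTwoSpace n) (C : Set (PSpace n)) : Prop :=
  (L.pts ∩ C).ncard = n - 1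

/-- The data space `(ℙⁿ)ᵖ × G(n-2, ℙⁿ)ˡ`: `p` points and `l` codimension two linear spaces. -/
structure Datum (n p l : ℕ) where
  /-- the points -/
  point : Fin p → PSpace n
  /-- the codimension two linear spaces -/
  space : Fin l → CodimTwoSpace n

/-- `C` is a rational normal curve through all the points of the datum and `(n - 1)`-secant to all
its linear spaces. -/
def Datum.IsSolution {n p l : ℕ} (δ : Datum n p l) (C : Set (PSpace n)) : Prop :=
  IsRationalNormalCurve n C ∧ (∀ i, δ.point i ∈ C) ∧ ∀ j, IsSecant (δ.space j) C

/-- Indices for the coordinates that describe a datum: `n + 1` homogeneous coordinates for every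
point and the coefficients of two linear equations for every linear space. -/
abbrev CoordIndex (n p l : ℕ) : Type :=
  (Fin p × Fin (n + 1)) ⊕ (Fin l × Fin 2 × Fin (n + 1))

/-- `c` describes the datum `δ`: the `i`-th point is `[c (i, 0) : ⋯ : c (i, n)]`, and the `j`-th
linear space is cut out by the two linear forms with coefficients `c (j, 0, ·)` and `c (j, 1, ·)`
(these are linearly independent, because the space has codimension two). -/
def Datum.HasCoords {n p l : ℕ} (δ : Datum n p l) (c : CoordIndex n p l → ℂ) : Prop :=
  (∀ i, ∃ h : (fun m => c (Sum.inl (i, m))) ≠ 0,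
      δ.point i = Projectivization.mk ℂ (fun m => c (Sum.inl (i, m))) h) ∧
  ∀ j, ∀ x : Fin (n + 1) → ℂ,
    x ∈ (δ.space j).1 ↔ ∀ k : Fin 2, ∑ m, c (Sum.inr (j, k, m)) * x m = 0

/-- Zariski open subsets of the data space: the topology is the quotient of the Zariski topology on
the tuples of coordinates, so `U` is open if and only if the coordinate tuples of its elements are,
among all coordinate tuples of data, the complement of the zero locus of a set of polynomials. -/
def IsZariskiOpen {n p l : ℕ} (U : Set (Datum n p l)) : Prop :=
  ∃ S : Set (MvPolynomial (CoordIndex n p l) ℂ),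
    ∀ (δ : Datum n p l) (c : CoordIndex n p l → ℂ), δ.HasCoords c →
      (δ ∈ U ↔ ∃ F ∈ S, MvPolynomial.eval c F ≠ 0)

/-- `Q` holds for `p` points and `l` codimension two linear spaces in generic position: it holds on
a nonempty Zariski open subset of the (irreducible) data space. -/
def Generically {n p l : ℕ} (Q : Datum n p l → Prop) : Prop :=
  ∃ U : Set (Datum n p l), IsZariskiOpen U ∧ U.Nonempty ∧ ∀ δ ∈ U, Q δ

/-!
Put the first point `P` at the parameter `∞` of a parametrization `φ` of the curve, of degree `n`.
Forms on `ℂⁿ⁺¹` pull back to polynomials of degree at most `n`, those that vanish at `P` to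
polynomials of degree less than `n`, so multiplication by the parameter becomes a linear operator
`T` from the forms that vanish at `P` to all forms. The curve is determined by `T`, as the set of
points `x` at which `ε ↦ T ε` and `ε ↦ ε` are proportional (`IsParam.inCone_iff`), and the maximal
minors of the pencil `X * ε - T ε` parametrize it (`pull_minorParam`).

In terms of `T`, the geometric conditions are linear. The curve passes through a point `Q ≠ P` if
and only if `Q` is an eigenvector of the transpose of `T`. A codimension two space not through `P`
is `(n - 1)`-secant if and only if its two equations pull back to multiples of one polynomial `h` of
degree `n - 1` with distinct roots; then the member of the pencil of equations that vanishes at `P`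
pulls back to a multiple of `h`, and `T` maps it into the pencil. So the operators are the solutions
of a linear system (`IsOperator`, `exists_isOperator_of_isSolution`, `IsOperator.isSolution`), in
which `T` may be changed by multiples of the inclusion. For `p + l = n + 3`, after one coefficient
is normalized to exclude the inclusion, there is one equation less than unknowns. By Cramer's rule,
if the space of solutions is one-dimensional for one datum, it is so generically, and the solution
is polynomial in the coordinates of the datum. Existence and uniqueness for a generic datum hence
follow from examples (`generically_existsUnique_of_example`).

The examples lie on the standard curve. A space that is spanned by the zeros of `h` has the pencil
of equations `⟨h, X * h⟩`, and the linear system describes maps from polynomials of degree less than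
`n` to polynomials of degree at most `n` that send `h` into this pencil and have evaluations at the
points as eigenvectors. For `l ≤ 1` or `l ≥ n` these are only the multiplications by affine
functions, if the polynomials `h` are chosen well (`exists_eq_affine_mul`): for `l ≥ n` one takes
the monomials, so that `T` is described by `n` affine functions, which the remaining conditions
force to be equal. That these `h` have multiple roots does no harm, because the roots are distinct
for other `h`, and finitely many nonempty open conditions can be satisfied together.

For `p ≥ 4` and `l ≥ 2`, the projection from an `(n - 1)`-secant space restricts to an isomorphism
from the curve to `ℙ¹`. So the projections from two of the spaces map four of the points to
quadruples with the same cross ratio (`IsOperator.crossRatioTest_eq_zero`), which is false for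
generic data. Two generic properties hold simultaneously for some datum
(`Generically.exists_and`), so in these cases the generic datum does not have a unique curve either.
-/

/-! ### Polynomial functions on affine space -/

namespace SecantRNC

section PolynomialFunctions

open Polynomial

variable {σ τ ι : Type*}

/-- The complex-valued functions on affine space `σ → ℂ` that are given by a polynomial. -/
def IsPolyFun (f : (σ → ℂ) → ℂ) : Prop :=
  ∃ F : MvPolynomial σ ℂ, ∀ c, MvPolynomial.eval c F = f c

lemma IsPolyFun.const (a : ℂ) : IsPolyFun (fun _ : σ → ℂ => a) :=
  ⟨MvPolynomial.C a, by simp⟩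

lemma IsPolyFun.coord (s : σ) : IsPolyFun (fun c : σ → ℂ => c s) :=
  ⟨MvPolynomial.X s, by simp⟩

lemma IsPolyFun.add {f g : (σ → ℂ) → ℂ} (hf : IsPolyFun f) (hg : IsPolyFun g) :
    IsPolyFun (fun c => f c + g c) := by
  obtain ⟨F, hF⟩ := hf
  obtain ⟨G, hG⟩ := hg
  exact ⟨F + G, by simp [hF, hG]⟩

lemma IsPolyFun.mul {f g : (σ → ℂ) → ℂ} (hf : IsPolyFun f) (hg : IsPolyFun g) :
    IsPolyFun (fun c => f c * g c) := by
  obtain ⟨F, hF⟩ := hf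
  obtain ⟨G, hG⟩ := hg
  exact ⟨F * G, by simp [hF, hG]⟩

lemma IsPolyFun.neg {f : (σ → ℂ) → ℂ} (hf : IsPolyFun f) : IsPolyFun (fun c => -f c) := by
  simpa using (IsPolyFun.const (-1)).mul hf

lemma IsPolyFun.sub {f g : (σ → ℂ) → ℂ} (hf : IsPolyFun f) (hg : IsPolyFun g) :
    IsPolyFun (fun c => f c - g c) := by
  simpa [sub_eq_add_neg] using hf.add hg.neg

lemma IsPolyFun.sum {s : Finset ι} {f : ι → (σ → ℂ) → ℂ} (h : ∀ i ∈ s, IsPolyFun (f i)) :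
    IsPolyFun (fun c => ∑ i ∈ s, f i c) := by
  classical
  induction s using Finset.induction_on with
  | empty => simpa using IsPolyFun.const 0
  | insert a s ha ih =>
    simp only [Finset.sum_insert ha]
    exact (h a (by simp)).add (ih fun i hi => h i (by simp [hi]))

lemma IsPolyFun.prod {s : Finset ι} {f : ι → (σ → ℂ) → ℂ} (h : ∀ i ∈ s, IsPolyFun (f i)) :
    IsPolyFun (fun c => ∏ i ∈ s, f i c) := by
  classical
  induction s using Finset.induction_on with
  | empty => simpa using IsPolyFun.const 1
  | insert a s ha ih =>
    simp only [Finset.prod_insert ha]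
    exact (h a (by simp)).mul (ih fun i hi => h i (by simp [hi]))

lemma IsPolyFun.det [Fintype ι] [DecidableEq ι] {A : (σ → ℂ) → Matrix ι ι ℂ}
    (h : ∀ i j, IsPolyFun (fun c => A c i j)) : IsPolyFun (fun c => (A c).det) := by
  simp only [Matrix.det_apply']
  exact IsPolyFun.sum fun π _ => (IsPolyFun.const _).mul (IsPolyFun.prod fun i _ => h _ _)

lemma IsPolyFun.comp {f : (σ → ℂ) → ℂ} (hf : IsPolyFun f) {g : (τ → ℂ) → σ → ℂ}
    (hg : ∀ s, IsPolyFun (fun y => g y s)) : IsPolyFun (fun y => f (g y)) := by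
  obtain ⟨F, hF⟩ := hf
  choose G hG using hg
  refine ⟨MvPolynomial.bind₁ G F, fun y => ?_⟩
  have hy : g y = fun s => MvPolynomial.aeval y (G s) := by
    funext s
    rw [MvPolynomial.aeval_eq_eval, hG]
  beta_reduce
  rw [← hF, hy, ← MvPolynomial.aeval_eq_eval, ← MvPolynomial.aeval_eq_eval]
  exact MvPolynomial.aeval_bind₁ _ _ _

/-- Affine space is irreducible: finitely many nonempty principal open sets have a common point. -/
lemma IsPolyFun.exists_forall_ne_zero {s : Finset ι} {f : ι → (σ → ℂ) → ℂ}
    (h : ∀ i ∈ s, IsPolyFun (f i)) (h0 : ∀ i ∈ s, ∃ c, f i c ≠ 0) :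
    ∃ c, ∀ i ∈ s, f i c ≠ 0 := by
  choose! F hF using h
  have hne : ∏ i ∈ s, F i ≠ 0 := by
    rw [Finset.prod_ne_zero_iff]
    intro i hi h
    obtain ⟨c, hc⟩ := h0 i hi
    exact hc (by rw [← hF i hi, h, map_zero])
  have : ∃ c, MvPolynomial.eval c (∏ i ∈ s, F i) ≠ 0 := by
    by_contra! h
    exact hne (MvPolynomial.funext fun c => by simpa using h c)
  obtain ⟨c, hc⟩ := this
  rw [map_prod, Finset.prod_ne_zero_iff] at hc
  exact ⟨c, fun i hi => by rw [← hF i hi]; exact hc i hi⟩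

/-- Univariate polynomials whose coefficients are polynomial functions of a parameter. -/
def IsPolyFamily (g : (σ → ℂ) → ℂ[X]) : Prop := ∀ k, IsPolyFun (fun c => (g c).coeff k)

lemma IsPolyFamily.const (g : ℂ[X]) : IsPolyFamily (fun _ : σ → ℂ => g) :=
  fun _ => IsPolyFun.const _

lemma IsPolyFamily.C {f : (σ → ℂ) → ℂ} (hf : IsPolyFun f) :
    IsPolyFamily (fun c => Polynomial.C (f c)) := by
  intro k
  by_cases hk : k = 0
  · simpa [hk] using hf
  · simpa [coeff_C, hk] using IsPolyFun.const 0

lemma IsPolyFamily.sub {f g : (σ → ℂ) → ℂ[X]} (hf : IsPolyFamily f) (hg : IsPolyFamily g) :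
    IsPolyFamily (fun c => f c - g c) := fun k => by
  simpa using (hf k).sub (hg k)

lemma IsPolyFamily.mul {f g : (σ → ℂ) → ℂ[X]} (hf : IsPolyFamily f) (hg : IsPolyFamily g) :
    IsPolyFamily (fun c => f c * g c) := fun k => by
  simp only [coeff_mul]
  exact IsPolyFun.sum fun i _ => (hf _).mul (hg _)

lemma IsPolyFamily.sum {s : Finset ι} {f : ι → (σ → ℂ) → ℂ[X]} (h : ∀ i ∈ s, IsPolyFamily (f i)) :
    IsPolyFamily (fun c => ∑ i ∈ s, f i c) := fun k => by
  simp only [finsetSum_coeff]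
  exact IsPolyFun.sum fun i hi => h i hi k

lemma IsPolyFamily.prod {s : Finset ι} {f : ι → (σ → ℂ) → ℂ[X]}
    (h : ∀ i ∈ s, IsPolyFamily (f i)) : IsPolyFamily (fun c => ∏ i ∈ s, f i c) := by
  classical
  induction s using Finset.induction_on with
  | empty => simpa using IsPolyFamily.const 1
  | insert a s ha ih =>
    simp only [Finset.prod_insert ha]
    exact (h a (by simp)).mul (ih fun i hi => h i (by simp [hi]))

lemma IsPolyFamily.det [Fintype ι] [DecidableEq ι] {A : (σ → ℂ) → Matrix ι ι ℂ[X]}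
    (h : ∀ i j, IsPolyFamily (fun c => A c i j)) : IsPolyFamily (fun c => (A c).det) := by
  simp only [Matrix.det_apply']
  exact IsPolyFamily.sum fun π _ => (IsPolyFamily.const _).mul (IsPolyFamily.prod fun i _ => h _ _)

lemma IsPolyFamily.derivative {g : (σ → ℂ) → ℂ[X]} (hg : IsPolyFamily g) :
    IsPolyFamily (fun c => Polynomial.derivative (g c)) := fun k => by
  simp only [coeff_derivative]
  exact (hg _).mul (IsPolyFun.const _)

lemma IsPolyFamily.resultant {f g : (σ → ℂ) → ℂ[X]} (hf : IsPolyFamily f) (hg : IsPolyFamily g)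
    (m k : ℕ) : IsPolyFun (fun c => Polynomial.resultant (f c) (g c) m k) := by
  refine IsPolyFun.det fun i j => ?_
  simp only [sylvester, Matrix.of_apply]
  induction j using Fin.addCases with
  | left j =>
    simp only [Fin.addCases_left]
    split_ifs
    · exact hg _
    · exact IsPolyFun.const 0
  | right j =>
    simp only [Fin.addCases_right]
    split_ifs
    · exact hf _
    · exact IsPolyFun.const 0

/-- A polynomial function of the coefficients of `h` that does not vanish if and only if `h`, of
degree at most `m`, has `m` distinct roots: the leading coefficient times the resultant of `h` and
its derivative. -/
noncomputable def rootsTest (m : ℕ) (h : ℂ[X]) : ℂ :=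
  h.coeff m * resultant h (derivative h) m (m - 1)

lemma IsPolyFamily.rootsTest {g : (σ → ℂ) → ℂ[X]} (hg : IsPolyFamily g) (m : ℕ) :
    IsPolyFun (fun c => rootsTest m (g c)) :=
  (hg m).mul (hg.resultant hg.derivative _ _)

lemma rootsTest_ne_zero_iff_separable {m : ℕ} {h : ℂ[X]} (hm : h.natDegree = m) (h0 : h ≠ 0) :
    rootsTest m h ≠ 0 ↔ h.Separable := by
  subst hm
  have hl : h.coeff h.natDegree ≠ 0 := by simpa using h0
  rw [rootsTest, ← natDegree_derivative, mul_ne_zero_iff, and_iff_right hl, ne_eq,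
    resultant_eq_zero_iff]
  simp [h0, Separable]

lemma rootsTest_ne_zero {m : ℕ} {h : ℂ[X]} (hm : h.natDegree ≤ m) (h0 : h ≠ 0) (s : Finset ℂ)
    (hs : s.card = m) (hr : ∀ x ∈ s, h.eval x = 0) : rootsTest m h ≠ 0 := by
  have hle : s.val ≤ h.roots := by
    rw [Multiset.le_iff_subset s.nodup]
    intro x hx
    exact (mem_roots h0).2 (hr x hx)
  have hc := Multiset.card_le_card hle
  have hd : h.roots.card ≤ h.natDegree := card_roots' h
  have hm' : h.natDegree = m := le_antisymm hm (by rw [← hs]; exact hc.trans hd)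
  rw [rootsTest_ne_zero_iff_separable hm' h0]
  have heq : s.val = h.roots := Multiset.eq_of_le_of_card_le hle (by
    change _ ≤ s.card
    omega)
  rw [← nodup_roots_iff_of_splits h0 (IsAlgClosed.splits h), ← heq]
  exact s.nodup

lemma ncard_roots_of_rootsTest_ne_zero {m : ℕ} {h : ℂ[X]} (hm : h.natDegree ≤ m)
    (ht : rootsTest m h ≠ 0) : {x | h.eval x = 0}.ncard = m := by
  have hc : h.coeff m ≠ 0 := left_ne_zero_of_mul ht
  have h0 : h ≠ 0 := by rintro rfl; simp at hc
  have hm' : h.natDegree = m := le_antisymm hm (le_natDegree_of_ne_zero hc)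
  have hsep := (rootsTest_ne_zero_iff_separable hm' h0).1 ht
  have : {x | h.eval x = 0} = (h.roots.toFinset : Set ℂ) := by
    ext x
    simp [h0]
  rw [this, Set.ncard_coe_finset, Multiset.toFinset_card_of_nodup (nodup_roots hsep), ← hm']
  exact (splits_iff_card_roots.1 (IsAlgClosed.splits h))

end PolynomialFunctions

/-! ### Kernels of linear systems with polynomial coefficients -/

section Kernels

open Matrix

/-- A vector orthogonal to `n` independent vectors of `ℂⁿ⁺¹` is determined up to a scalar. -/
lemma exists_eq_smul_of_orthogonal {n : ℕ} {v : Fin n → Fin (n + 1) → ℂ}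
    (hv : LinearIndependent ℂ v) {x y : Fin (n + 1) → ℂ} (hy : y ≠ 0)
    (hvy : ∀ k, v k ⬝ᵥ y = 0) (hvx : ∀ k, v k ⬝ᵥ x = 0) : ∃ s : ℂ, x = s • y := by
  set A : Matrix (Fin n) (Fin (n + 1)) ℂ := Matrix.of v with hA
  have hr : A.rank = n := by
    simpa using LinearIndependent.rank_matrix (M := A) hv
  have hk : Module.finrank ℂ (LinearMap.ker A.mulVecLin) = 1 := by
    have := A.mulVecLin.finrank_range_add_finrank_ker
    rw [← Matrix.rank, hr] at this
    simp at this
    omega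
  have hmem : ∀ z : Fin (n + 1) → ℂ, (∀ k, v k ⬝ᵥ z = 0) → z ∈ LinearMap.ker A.mulVecLin := by
    intro z hz
    rw [LinearMap.mem_ker]
    funext k
    exact hz k
  obtain ⟨s, hs⟩ := (finrank_eq_one_iff_of_nonzero' (⟨y, hmem y hvy⟩ : LinearMap.ker A.mulVecLin)
    (by simpa [Subtype.ext_iff] using hy)).1 hk ⟨x, hmem x hvx⟩
  exact ⟨s, by simpa [Subtype.ext_iff] using hs.symm⟩

/-- Consider a homogeneous linear system with one equation less than unknowns, whose coefficients
are polynomial functions of a parameter `c`. If the solutions at one parameter are determined by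
the value of one unknown, then there is a solution `w` that is polynomial in `c` and spans the space
of solutions wherever a certain polynomial `D` does not vanish (Cramer's rule). -/
lemma exists_polynomial_kernel {σ U E : Type*} [Fintype U] [Fintype E] [DecidableEq U]
    (hcard : Fintype.card U = Fintype.card E + 1) (B : (σ → ℂ) → (U → ℂ) →ₗ[ℂ] (E → ℂ))
    (hB : ∀ x e, IsPolyFun (fun c => B c x e)) (c₀ : σ → ℂ) (u : U)
    (h₀ : ∀ x, B c₀ x = 0 → x u = 0 → x = 0) :
    ∃ (D : (σ → ℂ) → ℂ) (w : (σ → ℂ) → U → ℂ), IsPolyFun D ∧ (∀ v, IsPolyFun (fun c => w c v)) ∧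
      D c₀ ≠ 0 ∧ (∀ c, B c (w c) = 0) ∧ ∀ c, D c ≠ 0 → w c ≠ 0 ∧
        ∀ x, B c x = 0 → ∃ s : ℂ, x = s • w c := by
  classical
  let e : U ≃ Option E := Fintype.equivOfCardEq (by simp [hcard])
  let A : (σ → ℂ) → (U → ℂ) →ₗ[ℂ] (U → ℂ) := fun c =>
    LinearMap.pi fun v => (e v).elim (LinearMap.proj u) fun i => LinearMap.proj i ∘ₗ B c
  have hAn : ∀ c x, A c x (e.symm none) = x u := by
    intro c x; simp [A]
  have hAs : ∀ c x i, A c x (e.symm (some i)) = B c x i := by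
    intro c x i; simp [A]
  let M : (σ → ℂ) → Matrix U U ℂ := fun c => LinearMap.toMatrix' (A c)
  have hM : ∀ c x, M c *ᵥ x = A c x := fun c x => by simp [M]
  have hMp : ∀ i j, IsPolyFun (fun c => M c i j) := by
    intro i j
    simp only [M, LinearMap.toMatrix'_apply, A, LinearMap.pi_apply]
    cases e i with
    | none => exact IsPolyFun.const _
    | some i => exact hB _ _
  let w : (σ → ℂ) → U → ℂ := fun c => (M c).adjugate *ᵥ Pi.single (e.symm none) 1
  have hw : ∀ c, A c (w c) = (M c).det • Pi.single (e.symm none) 1 := by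
    intro c
    rw [← hM, Matrix.mulVec_mulVec, Matrix.mul_adjugate, Matrix.smul_mulVec, Matrix.one_mulVec]
  refine ⟨fun c => (M c).det, w, IsPolyFun.det hMp, ?_, ?_, ?_, ?_⟩
  · intro v
    simp only [w, Matrix.mulVec_single_one, Matrix.col_apply, Matrix.adjugate_apply]
    refine IsPolyFun.det fun i j => ?_
    simp only [Matrix.updateRow_apply]
    split_ifs
    · exact IsPolyFun.const _
    · exact hMp _ _
  · have : Function.Injective (M c₀).mulVec := by
      have : Function.Injective (M c₀).mulVecLin := by
        rw [injective_iff_map_eq_zero]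
        intro x hx
        rw [Matrix.mulVecLin_apply, hM] at hx
        refine h₀ x ?_ (by rw [← hAn c₀ x, hx]; rfl)
        funext i
        rw [← hAs, hx]; rfl
      exact this
    rw [Matrix.mulVec_injective_iff_isUnit, Matrix.isUnit_iff_isUnit_det] at this
    exact this.ne_zero
  · intro c
    funext i
    rw [← hAs, hw]
    simp
  · intro c hD
    have hu : w c u = (M c).det := by
      rw [← hAn c (w c), hw]; simp
    refine ⟨fun h => hD (hu.symm.trans (by rw [h]; rfl)), fun x hx => ⟨x u / (M c).det, ?_⟩⟩
    have hinj : Function.Injective (M c).mulVec :=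
      Matrix.mulVec_injective_iff_isUnit.2
        ((Matrix.isUnit_iff_isUnit_det _).2 (isUnit_iff_ne_zero.2 hD))
    apply hinj
    rw [hM, Matrix.mulVec_smul, hM, hw, smul_smul, div_mul_cancel₀ _ hD]
    funext v
    obtain ⟨v, rfl⟩ := e.symm.surjective v
    cases v with
    | none => rw [hAn]; simp
    | some i => rw [hAs, hx]; simp

end Kernels

end SecantRNC

/-! ### Coordinates on the data space -/

namespace SecantRNC

section DataSpace

open Matrix

variable {n p l : ℕ}

/-- The homogeneous coordinate vector of the `i`-th point. -/
abbrev pt (c : CoordIndex n p l → ℂ) (i : Fin p) : Fin (n + 1) → ℂ := fun m => c (Sum.inl (i, m))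

/-- The coefficient vector of the `k`-th equation of the `j`-th linear space. -/
abbrev eqn (c : CoordIndex n p l → ℂ) (j : Fin l) (k : Fin 2) : Fin (n + 1) → ℂ :=
  fun m => c (Sum.inr (j, k, m))

lemma pt_ne_zero {δ : Datum n p l} {c : CoordIndex n p l → ℂ} (h : δ.HasCoords c) (i : Fin p) :
    pt c i ≠ 0 := (h.1 i).1

lemma mem_space_iff {δ : Datum n p l} {c : CoordIndex n p l → ℂ} (h : δ.HasCoords c) (j : Fin l)
    (x : Fin (n + 1) → ℂ) : x ∈ (δ.space j).1 ↔ ∀ k, eqn c j k ⬝ᵥ x = 0 := h.2 j x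

lemma finrank_quotient_ker_eq_two_iff (A : Fin 2 → Fin (n + 1) → ℂ) :
    Module.finrank ℂ ((Fin (n + 1) → ℂ) ⧸ LinearMap.ker (Matrix.of A).mulVecLin) = 2 ↔
      LinearIndependent ℂ A := by
  rw [(Matrix.of A).mulVecLin.quotKerEquivRange.finrank_eq, ← Matrix.rank,
    Matrix.rank_eq_finrank_span_row, linearIndependent_iff_card_eq_finrank_span, Set.finrank,
    Fintype.card_fin, eq_comm]
  rfl

lemma mem_ker_of_mulVecLin (A : Fin 2 → Fin (n + 1) → ℂ) (x : Fin (n + 1) → ℂ) :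
    x ∈ LinearMap.ker (Matrix.of A).mulVecLin ↔ ∀ k, A k ⬝ᵥ x = 0 := by
  rw [LinearMap.mem_ker, funext_iff]
  rfl

lemma linearIndependent_eqn {δ : Datum n p l} {c : CoordIndex n p l → ℂ} (h : δ.HasCoords c)
    (j : Fin l) : LinearIndependent ℂ (eqn c j) := by
  rw [← finrank_quotient_ker_eq_two_iff]
  have : LinearMap.ker (Matrix.of (eqn c j)).mulVecLin = (δ.space j).1 := by
    ext x
    rw [mem_ker_of_mulVecLin, mem_space_iff h]
  rw [this]
  exact (δ.space j).2

lemma exists_hasCoords_of_linearIndependent (c : CoordIndex n p l → ℂ) (hP : ∀ i, pt c i ≠ 0)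
    (hL : ∀ j, LinearIndependent ℂ (eqn c j)) : ∃ δ : Datum n p l, δ.HasCoords c :=
  ⟨⟨fun i => Projectivization.mk ℂ (pt c i) (hP i),
    fun j => ⟨LinearMap.ker (Matrix.of (eqn c j)).mulVecLin,
      (finrank_quotient_ker_eq_two_iff _).2 (hL j)⟩⟩,
    fun i => ⟨hP i, rfl⟩, fun _ x => mem_ker_of_mulVecLin _ x⟩

lemma exists_hasCoords (δ : Datum n p l) : ∃ c, δ.HasCoords c := by
  let b : ∀ j, Module.Basis (Fin 2) ℂ ((Fin (n + 1) → ℂ) ⧸ (δ.space j).1) := fun j =>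
    Module.finBasisOfFinrankEq ℂ _ (δ.space j).2
  refine ⟨Sum.elim (fun im => (δ.point im.1).rep im.2) fun jkm =>
    (b jkm.1).coord jkm.2.1 ((δ.space jkm.1).1.mkQ (Pi.single jkm.2.2 1)), fun i =>
      ⟨(δ.point i).rep_nonzero, ((δ.point i).mk_rep).symm⟩, fun j x => ?_⟩
  have key : ∀ k, ∑ m, (b j).coord k ((δ.space j).1.mkQ (Pi.single m 1)) * x m =
      (b j).coord k ((δ.space j).1.mkQ x) := by
    intro k
    conv_rhs => rw [pi_eq_sum_univ' x]
    simp [mul_comm]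
  simp only [Sum.elim_inr]
  simp_rw [key]
  rw [← Submodule.Quotient.mk_eq_zero, ← Submodule.mkQ_apply, ← (b j).forall_coord_eq_zero_iff]

/-- The coordinates obtained by rescaling the points by `u` and changing the equations of the linear
spaces by the matrices `A`. -/
def changeCoords (u : Fin p → ℂ) (A : Fin l → Matrix (Fin 2) (Fin 2) ℂ)
    (c : CoordIndex n p l → ℂ) : CoordIndex n p l → ℂ :=
  Sum.elim (fun im => u im.1 * c (Sum.inl im))
    (fun jkm => ∑ k, A jkm.1 jkm.2.1 k * c (Sum.inr (jkm.1, k, jkm.2.2)))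

lemma eqn_changeCoords_dotProduct (u : Fin p → ℂ) (A : Fin l → Matrix (Fin 2) (Fin 2) ℂ)
    (c : CoordIndex n p l → ℂ) (j : Fin l) (k : Fin 2) (x : Fin (n + 1) → ℂ) :
    eqn (changeCoords u A c) j k ⬝ᵥ x = (A j *ᵥ fun k => eqn c j k ⬝ᵥ x) k := by
  simp only [dotProduct, changeCoords, Sum.elim_inr, Matrix.mulVec, Finset.sum_mul,
    Finset.mul_sum]
  rw [Finset.sum_comm]
  simp [mul_assoc]

lemma hasCoords_changeCoords {δ : Datum n p l} {c : CoordIndex n p l → ℂ} (h : δ.HasCoords c)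
    {u : Fin p → ℂ} (hu : ∀ i, u i ≠ 0) {A : Fin l → Matrix (Fin 2) (Fin 2) ℂ}
    (hA : ∀ j, IsUnit (A j)) : δ.HasCoords (changeCoords u A c) := by
  refine ⟨fun i => ?_, fun j x => ?_⟩
  · obtain ⟨h0, hi⟩ := h.1 i
    have h1 : (fun m => changeCoords u A c (Sum.inl (i, m))) = u i • pt c i := rfl
    refine ⟨by rw [h1]; exact smul_ne_zero (hu i) h0, ?_⟩
    rw [hi, Projectivization.mk_eq_mk_iff']
    exact ⟨(u i)⁻¹, by rw [h1, smul_smul, inv_mul_cancel₀ (hu i), one_smul]⟩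
  · have h2 : (∀ k, eqn (changeCoords u A c) j k ⬝ᵥ x = 0) ↔
        A j *ᵥ (fun k => eqn c j k ⬝ᵥ x) = 0 := by
      simp only [eqn_changeCoords_dotProduct, funext_iff, Pi.zero_apply]
    refine Iff.trans ?_ h2.symm
    rw [mem_space_iff h, ← Matrix.mulVec_zero (A j),
      (Matrix.mulVec_injective_iff_isUnit.2 (hA j)).eq_iff, funext_iff]
    rfl

lemma exists_eq_changeCoords {δ : Datum n p l} {c c' : CoordIndex n p l → ℂ} (h : δ.HasCoords c)
    (h' : δ.HasCoords c') : ∃ (u : Fin p → ℂ) (A : Fin l → Matrix (Fin 2) (Fin 2) ℂ),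
      (∀ i, u i ≠ 0) ∧ (∀ j, IsUnit (A j)) ∧ c' = changeCoords u A c := by
  have h1 : ∀ i, ∃ u : ℂ, u • pt c i = pt c' i := by
    intro i
    obtain ⟨h0, hi⟩ := h.1 i
    obtain ⟨h0', hi'⟩ := h'.1 i
    rw [hi] at hi'
    exact (Projectivization.mk_eq_mk_iff' ℂ _ _ h0' h0).1 hi'.symm
  have h2 : ∀ j k, ∃ a : Fin 2 → ℂ, ∑ k', a k' • eqn c j k' = eqn c' j k := by
    intro j k
    let f : (Fin (n + 1) → ℂ) ≃ₗ[ℂ] Module.Dual ℂ (Fin (n + 1) → ℂ) := dotProductEquiv ℂ _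
    have hf : ∀ v x, f v x = v ⬝ᵥ x := fun v x => rfl
    have : f (eqn c' j k) ∈ Submodule.span ℂ (Set.range fun k' => f (eqn c j k')) := by
      apply mem_span_of_iInf_ker_le_ker
      intro x hx
      simp only [Submodule.mem_iInf, LinearMap.mem_ker, hf] at hx ⊢
      exact (mem_space_iff h' j x).1 ((mem_space_iff h j x).2 hx) k
    obtain ⟨a, ha⟩ := (Submodule.mem_span_range_iff_exists_fun ℂ).1 this
    refine ⟨a, f.injective ?_⟩
    rw [← ha, map_sum]
    simp
  choose u hu using h1
  choose a ha using h2
  refine ⟨u, fun j => Matrix.of (a j), ?_, ?_, ?_⟩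
  · rintro i h0
    apply pt_ne_zero h' i
    rw [← hu, h0, zero_smul]
  · intro j
    rw [← Matrix.linearIndependent_rows_iff_isUnit]
    have hli := linearIndependent_eqn h' j
    rw [Fintype.linearIndependent_iff] at hli ⊢
    intro g hg
    apply hli
    simp_rw [← ha, Finset.smul_sum, smul_smul]
    rw [Finset.sum_comm]
    refine Finset.sum_eq_zero fun k _ => ?_
    rw [← Finset.sum_smul]
    have := congrFun hg k
    simp only [Finset.sum_apply, Pi.smul_apply, smul_eq_mul, Pi.zero_apply] at this
    change ∑ i, g i * a j i k = 0 at this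
    rw [this, zero_smul]
  · funext x
    rcases x with ⟨i, m⟩ | ⟨j, k, m⟩
    · exact (congrFun (hu i) m).symm
    · have := congrFun (ha j k) m
      simp only [Finset.sum_apply, Pi.smul_apply, smul_eq_mul] at this
      exact this.symm

/-- A property of data holds generically if it holds for all data with coordinates at which a
certain polynomial does not vanish, and there are such data. The open set consists of the data for
which *some* system of coordinates is not a zero of the polynomial, so no invariance of the
polynomial under changes of coordinates is needed. -/
lemma generically_of_isPolyFun {Q : Datum n p l → Prop} {F : (CoordIndex n p l → ℂ) → ℂ}
    (hF : IsPolyFun F) (hex : ∃ (δ : Datum n p l) (c : _), δ.HasCoords c ∧ F c ≠ 0)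
    (hQ : ∀ (δ : Datum n p l) (c : _), δ.HasCoords c → F c ≠ 0 → Q δ) : Generically Q := by
  refine ⟨{δ | ∃ c, δ.HasCoords c ∧ F c ≠ 0}, ?_, ?_, ?_⟩
  · refine ⟨{G | ∀ (δ : Datum n p l) (c : _), δ.HasCoords c → MvPolynomial.eval c G ≠ 0 →
      ∃ c', δ.HasCoords c' ∧ F c' ≠ 0}, fun δ c hc => ⟨?_, ?_⟩⟩
    · rintro ⟨c', hc', hFc'⟩
      obtain ⟨u, A, hu, hA, rfl⟩ := exists_eq_changeCoords hc hc'
      have hG : IsPolyFun (fun c : CoordIndex n p l → ℂ => F (changeCoords u A c)) := by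
        refine hF.comp fun s => ?_
        rcases s with ⟨i, m⟩ | ⟨j, k, m⟩
        · exact (IsPolyFun.const _).mul (IsPolyFun.coord _)
        · exact IsPolyFun.sum (s := Finset.univ)
            (f := fun k' c => A j k k' * c (Sum.inr (j, k', m)))
            fun k _ => (IsPolyFun.const _).mul (IsPolyFun.coord _)
      obtain ⟨G, hG⟩ := hG
      refine ⟨G, fun δ' c'' hc'' h => ⟨_, hasCoords_changeCoords hc'' hu hA, ?_⟩, ?_⟩
      · rwa [hG] at h
      · rwa [hG]
    · rintro ⟨G, hG, h⟩
      exact hG δ c hc h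
  · obtain ⟨δ, c, hc, h⟩ := hex
    exact ⟨δ, c, hc, h⟩
  · rintro δ ⟨c, hc, h⟩
    exact hQ δ c hc h

/-- The coordinates of data form an open subset of affine space. -/
lemma exists_isPolyFun_hasCoords {δ : Datum n p l} {c : CoordIndex n p l → ℂ} (h : δ.HasCoords c) :
    ∃ F : (CoordIndex n p l → ℂ) → ℂ, IsPolyFun F ∧ F c ≠ 0 ∧
      ∀ c', F c' ≠ 0 → ∃ δ' : Datum n p l, δ'.HasCoords c' := by
  have h1 : ∀ i, ∃ m, pt c i m ≠ 0 := fun i => Function.ne_iff.1 (pt_ne_zero h i)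
  choose m hm using h1
  have h2 : ∀ j, ∃ B : Matrix (Fin (n + 1)) (Fin 2) ℂ, (Matrix.of (eqn c j) * B).det ≠ 0 := by
    intro j
    have hr : (Matrix.of (eqn c j)).rank = 2 := by
      simpa using
        LinearIndependent.rank_matrix (M := Matrix.of (eqn c j)) (linearIndependent_eqn h j)
    have hs : Function.Surjective (Matrix.of (eqn c j)).mulVec :=
      (LinearMap.range_eq_top (f := (Matrix.of (eqn c j)).mulVecLin)).1
        (Submodule.eq_top_of_finrank_eq (hr.trans (by simp)))
    obtain ⟨B, hB⟩ := Matrix.mulVec_surjective_iff_exists_right_inverse.1 hs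
    exact ⟨B, by rw [hB]; simp⟩
  choose B hB using h2
  refine ⟨fun c => (∏ i, pt c i (m i)) * ∏ j, (Matrix.of (eqn c j) * B j).det, ?_, ?_, ?_⟩
  · exact (IsPolyFun.prod fun i _ => IsPolyFun.coord _).mul
      (IsPolyFun.prod fun j _ => IsPolyFun.det fun k k' =>
        IsPolyFun.sum (s := Finset.univ) (f := fun m c => eqn c j k m * B j m k')
          fun _ _ => (IsPolyFun.coord _).mul (IsPolyFun.const _))
  · exact mul_ne_zero (Finset.prod_ne_zero_iff.2 fun i _ => hm i)
      (Finset.prod_ne_zero_iff.2 fun j _ => hB j)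
  · intro c' hc'
    rw [mul_ne_zero_iff, Finset.prod_ne_zero_iff, Finset.prod_ne_zero_iff] at hc'
    refine exists_hasCoords_of_linearIndependent c'
      (fun i => Function.ne_iff.2 ⟨_, hc'.1 i (by simp)⟩) fun j => ?_
    have h3 := Matrix.linearIndependent_rows_iff_isUnit.2 ((Matrix.isUnit_iff_isUnit_det _).2
      (isUnit_iff_ne_zero.2 (hc'.2 j (by simp))))
    exact LinearIndependent.of_comp (B j).vecMulLinear h3

/-- The data space is irreducible: two properties of generic data hold at a common datum. -/
lemma Generically.exists_and {Q₁ Q₂ : Datum n p l → Prop} (h₁ : Generically Q₁)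
    (h₂ : Generically Q₂) : ∃ δ, Q₁ δ ∧ Q₂ δ := by
  obtain ⟨U₁, ⟨S₁, hS₁⟩, ⟨δ₁, hδ₁⟩, hU₁⟩ := h₁
  obtain ⟨U₂, ⟨S₂, hS₂⟩, ⟨δ₂, hδ₂⟩, hU₂⟩ := h₂
  obtain ⟨c₁, hc₁⟩ := exists_hasCoords δ₁
  obtain ⟨c₂, hc₂⟩ := exists_hasCoords δ₂
  obtain ⟨F₁, hF₁, hne₁⟩ := (hS₁ δ₁ c₁ hc₁).1 hδ₁
  obtain ⟨F₂, hF₂, hne₂⟩ := (hS₂ δ₂ c₂ hc₂).1 hδ₂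
  obtain ⟨F₃, hF₃, hne₃, hd⟩ := exists_isPolyFun_hasCoords hc₁
  obtain ⟨c, hc⟩ := IsPolyFun.exists_forall_ne_zero (s := Finset.univ)
    (f := ![fun c => MvPolynomial.eval c F₁, fun c => MvPolynomial.eval c F₂, F₃])
    (by
      intro i _
      fin_cases i
      exacts [⟨F₁, fun _ => rfl⟩, ⟨F₂, fun _ => rfl⟩, hF₃])
    (by
      intro i _
      fin_cases i
      exacts [⟨c₁, hne₁⟩, ⟨c₂, hne₂⟩, ⟨c₁, hne₃⟩])
  obtain ⟨δ, hδ⟩ := hd c (hc 2 (by simp))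
  exact ⟨δ, hU₁ δ ((hS₁ δ c hδ).2 ⟨F₁, hF₁, hc 0 (by simp)⟩),
    hU₂ δ ((hS₂ δ c hδ).2 ⟨F₂, hF₂, hc 1 (by simp)⟩)⟩

end DataSpace

end SecantRNC

/-! ### Affine parametrizations of rational normal curves -/

namespace SecantRNC

section Parametrizations

open Matrix Polynomial

variable {n : ℕ}

/-- `φ` is an affine parametrization of a rational normal curve of degree `n`: its components are
`n + 1` linearly independent polynomials of degree at most `n`. The point at infinity of the curve
is given by the coefficients of degree `n`. -/
structure IsParam (φ : Fin (n + 1) → ℂ[X]) : Prop where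
  natDegree_le : ∀ i, (φ i).natDegree ≤ n
  linearIndependent : LinearIndependent ℂ φ

/-- The point of the affine cone with parameter `t`. -/
def evalAt (φ : Fin (n + 1) → ℂ[X]) (t : ℂ) : Fin (n + 1) → ℂ := fun i => (φ i).eval t

/-- The point of the affine cone with parameter infinity. -/
def atInfty (φ : Fin (n + 1) → ℂ[X]) : Fin (n + 1) → ℂ := fun i => (φ i).coeff n

/-- The pullback of linear forms along `φ`: the form with coefficients `l` is sent to
`∑ i, l i • φ i`. -/
noncomputable def pull (φ : Fin (n + 1) → ℂ[X]) : (Fin (n + 1) → ℂ) →ₗ[ℂ] ℂ[X] :=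
  Fintype.linearCombination ℂ φ

lemma pull_apply (φ : Fin (n + 1) → ℂ[X]) (l : Fin (n + 1) → ℂ) : pull φ l = ∑ i, l i • φ i := rfl

lemma eval_pull (φ : Fin (n + 1) → ℂ[X]) (l : Fin (n + 1) → ℂ) (t : ℂ) :
    (pull φ l).eval t = l ⬝ᵥ evalAt φ t := by
  simp [pull_apply, dotProduct, evalAt, eval_finsetSum]

lemma coeff_pull (φ : Fin (n + 1) → ℂ[X]) (l : Fin (n + 1) → ℂ) :
    (pull φ l).coeff n = l ⬝ᵥ atInfty φ := by
  simp [pull_apply, dotProduct, atInfty]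

namespace IsParam

variable {φ : Fin (n + 1) → ℂ[X]} (hφ : IsParam φ)

include hφ

lemma natDegree_pull_le (l : Fin (n + 1) → ℂ) : (pull φ l).natDegree ≤ n :=
  pull_apply φ l ▸ natDegree_sum_le_of_forall_le _ _ fun i _ =>
    (natDegree_smul_le _ _).trans (hφ.natDegree_le i)

lemma pull_injective : Function.Injective (pull φ) :=
  hφ.linearIndependent.fintypeLinearCombination_injective

lemma pull_eq_zero_iff {l : Fin (n + 1) → ℂ} : pull φ l = 0 ↔ l = 0 :=
  map_eq_zero_iff _ hφ.pull_injective

/-- The hyperplanes cut out the complete linear system. -/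
lemma exists_pull_eq {g : ℂ[X]} (hg : g.natDegree ≤ n) : ∃ l, pull φ l = g := by
  have hmem : ∀ g : ℂ[X], g.natDegree ≤ n ↔ g ∈ degreeLT ℂ (n + 1) := by
    intro g
    rw [mem_degreeLT, degree_lt_iff_coeff_zero, natDegree_le_iff_coeff_eq_zero]
    rfl
  let f : (Fin (n + 1) → ℂ) →ₗ[ℂ] degreeLT ℂ (n + 1) :=
    (pull φ).codRestrict _ fun l => (hmem _).1 (hφ.natDegree_pull_le l)
  have hf : Function.Injective f := fun x y h =>
    hφ.pull_injective (congrArg Subtype.val h)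
  have hr : Module.finrank ℂ (Fin (n + 1) → ℂ) = Module.finrank ℂ (degreeLT ℂ (n + 1)) := by
    rw [(degreeLTEquiv ℂ (n + 1)).finrank_eq]
  have : Module.Finite ℂ (degreeLT ℂ (n + 1)) := Module.Finite.equiv (degreeLTEquiv ℂ (n + 1)).symm
  obtain ⟨l, hl⟩ := (LinearMap.injective_iff_surjective_of_finrank_eq_finrank hr).1 hf
    ⟨g, (hmem g).1 hg⟩
  exact ⟨l, congrArg Subtype.val hl⟩

lemma evalAt_ne_zero (t : ℂ) : evalAt φ t ≠ 0 := by
  intro h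
  obtain ⟨l, hl⟩ := hφ.exists_pull_eq (g := 1) (by simp)
  have := eval_pull φ l t
  rw [hl, h] at this
  simp at this

lemma atInfty_ne_zero : atInfty φ ≠ 0 := by
  intro h
  obtain ⟨l, hl⟩ := hφ.exists_pull_eq (g := X ^ n) (by simp)
  have := coeff_pull φ l
  rw [hl, h] at this
  simp at this

lemma evalAt_eq_smul_iff (hn : 1 ≤ n) {t t' s : ℂ} (h : evalAt φ t = s • evalAt φ t') : t = t' := by
  obtain ⟨l, hl⟩ := hφ.exists_pull_eq (g := X - C t') (by simpa using hn)
  have h1 := eval_pull φ l t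
  rw [h, dotProduct_smul, ← eval_pull, hl] at h1
  simpa [sub_eq_zero] using h1

end IsParam

/-- The affine cone over the curve parametrized by `φ`. -/
def InCone (φ : Fin (n + 1) → ℂ[X]) (x : Fin (n + 1) → ℂ) : Prop :=
  (∃ t s : ℂ, x = s • evalAt φ t) ∨ ∃ s : ℂ, x = s • atInfty φ

lemma InCone.smul {φ : Fin (n + 1) → ℂ[X]} {x : Fin (n + 1) → ℂ} (h : InCone φ x) (r : ℂ) :
    InCone φ (r • x) := by
  rcases h with ⟨t, s, rfl⟩ | ⟨s, rfl⟩
  · exact Or.inl ⟨t, r * s, by rw [smul_smul]⟩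
  · exact Or.inr ⟨r * s, by rw [smul_smul]⟩

/-- The projective curve parametrized by `φ`. -/
def curve (φ : Fin (n + 1) → ℂ[X]) : Set (PSpace n) := {Q | InCone φ Q.rep}

lemma mk_mem_curve_iff {φ : Fin (n + 1) → ℂ[X]} {x : Fin (n + 1) → ℂ} (hx : x ≠ 0) :
    Projectivization.mk ℂ x hx ∈ curve φ ↔ InCone φ x := by
  obtain ⟨a, ha⟩ := Projectivization.exists_smul_eq_mk_rep ℂ x hx
  have ha' : (Projectivization.mk ℂ x hx).rep = (a : ℂ) • x := ha.symm
  rw [curve, Set.mem_ofPred_eq, ha']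
  refine ⟨fun h => ?_, fun h => h.smul _⟩
  simpa [smul_smul] using h.smul (a : ℂ)⁻¹

lemma eq_add_of_mem_support {f : MvPolynomial (Fin 2) ℂ} (hf : f.IsHomogeneous n)
    {d : Fin 2 →₀ ℕ} (hd : d ∈ f.support) : n = d 0 + d 1 := by
  rw [hf.degree_eq_sum_deg_support hd, ← Fin.sum_univ_two]
  exact Finset.sum_subset (Finset.subset_univ _) (by simp)

lemma eval_smul_of_isHomogeneous {f : MvPolynomial (Fin 2) ℂ} (hf : f.IsHomogeneous n) (r : ℂ)
    (a : Fin 2 → ℂ) : MvPolynomial.eval (r • a) f = r ^ n * MvPolynomial.eval a f := by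
  rw [MvPolynomial.eval_eq', MvPolynomial.eval_eq', Finset.mul_sum]
  refine Finset.sum_congr rfl fun d hd => ?_
  simp only [Pi.smul_apply, smul_eq_mul, Fin.prod_univ_two, mul_pow]
  rw [eq_add_of_mem_support hf hd, pow_add]
  ring

lemma eval_homogenize_of_eq_zero (g : ℂ[X]) {a : Fin 2 → ℂ} (ha : a 1 = 0) :
    MvPolynomial.eval a (g.homogenize n) = a 0 ^ n * g.coeff n := by
  rw [homogenize, map_sum, Finset.sum_eq_single (n, 0)]
  · simp [MvPolynomial.eval_monomial, Finsupp.prod_fintype, Finsupp.update_apply, mul_comm]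
  · rintro ⟨k, m⟩ hkm hne
    have hm : m ≠ 0 := by
      rintro rfl
      have := Finset.HasAntidiagonal.mem_antidiagonal.1 hkm
      exact hne (by simp_all)
    simp [MvPolynomial.eval_monomial, Finsupp.prod_fintype, Finsupp.update_apply, ha, hm]
  · simp

lemma IsParam.isRationalNormalCurve {φ : Fin (n + 1) → ℂ[X]} (hφ : IsParam φ) :
    IsRationalNormalCurve n (curve φ) := by
  refine ⟨fun i => (φ i).homogenize n, fun i => isHomogeneous_homogenize _, ?_, ?_⟩
  · rw [Fintype.linearIndependent_iff]
    intro g hg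
    have h1 : (pull φ g).homogenize n = 0 := by
      rw [pull_apply, homogenize_finsetSum]
      simpa using hg
    rw [homogenize_eq_zero_iff (hφ.natDegree_pull_le g), hφ.pull_eq_zero_iff] at h1
    exact congrFun h1
  · have h0 : ∀ a : Fin 2 → ℂ, a 1 = 0 →
        (fun i => MvPolynomial.eval a ((φ i).homogenize n)) = a 0 ^ n • atInfty φ := by
      intro a ha
      funext i
      simp [eval_homogenize_of_eq_zero _ ha, atInfty]
    have h1 : ∀ a : Fin 2 → ℂ, a 1 ≠ 0 →
        (fun i => MvPolynomial.eval a ((φ i).homogenize n)) = a 1 ^ n • evalAt φ (a 0 / a 1) := by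
      intro a ha
      funext i
      simp [eval_homogenize (hφ.natDegree_le i) _ ha, evalAt, mul_comm]
    ext Q
    constructor
    · intro hQ
      have key : ∃ a : Fin 2 → ℂ, a ≠ 0 ∧ ∃ s : ℂ, Q.rep = s •
          (fun i => MvPolynomial.eval a ((φ i).homogenize n)) := by
        rcases hQ with ⟨t, s, h⟩ | ⟨s, h⟩
        · exact ⟨![t, 1], fun h => by simpa using congrFun h 1, s, by rw [h1 _ (by simp)]; simp [h]⟩
        · exact ⟨![1, 0], fun h => by simpa using congrFun h 0, s, by rw [h0 _ (by simp)]; simp [h]⟩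
      obtain ⟨a, ha, s, hs⟩ := key
      have hne : (fun i => MvPolynomial.eval a ((φ i).homogenize n)) ≠ 0 := by
        intro h
        exact Q.rep_nonzero (by rw [hs, h, smul_zero])
      refine ⟨a, ha, hne, ?_⟩
      conv_lhs => rw [← Q.mk_rep]
      exact (Projectivization.mk_eq_mk_iff' ℂ _ _ _ _).2 ⟨s, hs.symm⟩
    · rintro ⟨a, ha, hne, rfl⟩
      rw [mk_mem_curve_iff]
      by_cases h : a 1 = 0
      · rw [h0 a h]
        exact Or.inr ⟨_, rfl⟩
      · rw [h1 a h]
        exact Or.inl ⟨_, _, rfl⟩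

lemma natDegree_aeval_line_le {f : MvPolynomial (Fin 2) ℂ} (hf : f.IsHomogeneous n)
    (a b : Fin 2 → ℂ) : (MvPolynomial.aeval (fun k => C (a k) * X + C (b k)) f).natDegree ≤ n ∧
      (MvPolynomial.aeval (fun k => C (a k) * X + C (b k)) f).coeff n = MvPolynomial.eval a f := by
  have hlin : ∀ k, (C (a k) * X + C (b k)).natDegree ≤ 1 := fun k => natDegree_linear_le
  have hpow : ∀ k m, ((C (a k) * X + C (b k)) ^ m).natDegree ≤ m := fun k m => by
    simpa using natDegree_pow_le_of_le m (hlin k)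
  have hcoeff : ∀ k m, ((C (a k) * X + C (b k)) ^ m).coeff m = a k ^ m := fun k m => by
    have := coeff_pow_of_natDegree_le (m := m) (hlin k)
    simpa using this
  rw [MvPolynomial.aeval_eq_eval₂Hom, MvPolynomial.coe_eval₂Hom, MvPolynomial.eval₂_eq',
    MvPolynomial.eval_eq']
  have hd : ∀ d ∈ f.support, n = d 0 + d 1 := fun d => eq_add_of_mem_support hf
  refine ⟨natDegree_sum_le_of_forall_le _ _ fun d hd' => ?_, ?_⟩
  · rw [Fin.prod_univ_two, algebraMap_eq]
    refine (natDegree_C_mul_le _ _).trans (natDegree_mul_le.trans ?_)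
    rw [hd d hd']
    exact add_le_add (hpow 0 _) (hpow 1 _)
  · rw [finsetSum_coeff]
    refine Finset.sum_congr rfl fun d hd' => ?_
    rw [Fin.prod_univ_two, Fin.prod_univ_two, algebraMap_eq, coeff_C_mul, hd d hd',
      coeff_mul_add_eq_of_natDegree_le (hpow 0 _) (hpow 1 _), hcoeff, hcoeff]

/-- A rational normal curve has an affine parametrization with a given point at infinity. -/
lemma exists_isParam {C' : Set (PSpace n)} (hC : IsRationalNormalCurve n C') {P : Fin (n + 1) → ℂ}
    (hP : P ≠ 0) (hPC : Projectivization.mk ℂ P hP ∈ C') :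
    ∃ φ : Fin (n + 1) → ℂ[X], IsParam φ ∧ C' = curve φ ∧ ∃ s : ℂ, atInfty φ = s • P := by
  obtain ⟨f, hf, hli, rfl⟩ := hC
  obtain ⟨a, ha, hfa, hPa⟩ := hPC
  -- `a` and `b` form a basis of `ℂ²`.
  let b : Fin 2 → ℂ := ![-star (a 1), star (a 0)]
  have hdet : a 0 * b 1 - a 1 * b 0 ≠ 0 := by
    have : a 0 * b 1 - a 1 * b 0 = ((‖a 0‖ ^ 2 + ‖a 1‖ ^ 2 : ℝ) : ℂ) := by
      simp [b, Complex.mul_conj']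
    rw [this]
    norm_cast
    intro h
    apply ha
    have h0 : ‖a 0‖ = 0 := by nlinarith [sq_nonneg ‖a 0‖, sq_nonneg ‖a 1‖]
    have h1 : ‖a 1‖ = 0 := by nlinarith [sq_nonneg ‖a 0‖, sq_nonneg ‖a 1‖]
    funext i
    fin_cases i
    · simpa using h0
    · simpa using h1
  let φ : Fin (n + 1) → ℂ[X] := fun i => MvPolynomial.aeval (fun k => C (a k) * X + C (b k)) (f i)
  have hev : ∀ (g : MvPolynomial (Fin 2) ℂ) t,
      (MvPolynomial.aeval (fun k => C (a k) * X + C (b k)) g).eval t =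
      MvPolynomial.eval (t • a + b) g := by
    intro g t
    induction g using MvPolynomial.induction_on with
    | C r => simp
    | add p q hp hq => simp only [map_add, eval_add, hp, hq]
    | mul_X p k hp =>
      simp only [map_mul, eval_mul, hp, MvPolynomial.aeval_X, MvPolynomial.eval_X, eval_add, eval_C,
        eval_X, Pi.add_apply, Pi.smul_apply, smul_eq_mul]
      ring
  -- Every nonzero vector of `ℂ²` is proportional to `a` or to some `t • a + b`.
  have hvec : ∀ v : Fin 2 → ℂ, (∃ r t : ℂ, v = r • (t • a + b)) ∨ ∃ r : ℂ, v = r • a := by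
    intro v
    set D := a 0 * b 1 - a 1 * b 0
    set R := a 0 * v 1 - a 1 * v 0 with hR
    rcases eq_or_ne R 0 with hβ | hβ
    · rw [hR] at hβ
      refine Or.inr ⟨(v 0 * b 1 - v 1 * b 0) / D, ?_⟩
      funext i
      fin_cases i
      · simp only [Pi.smul_apply, smul_eq_mul, Fin.zero_eta]
        field_simp
        simp only [D]
        linear_combination (b 0) * hβ
      · simp only [Pi.smul_apply, smul_eq_mul, Fin.mk_one]
        field_simp
        simp only [D]
        linear_combination (b 1) * hβ
    · refine Or.inl ⟨R / D, (v 0 * b 1 - v 1 * b 0) / R, ?_⟩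
      funext i
      fin_cases i
      · simp only [Pi.smul_apply, Pi.add_apply, smul_eq_mul, Fin.zero_eta]
        field_simp
        simp only [D, R]
        ring
      · simp only [Pi.smul_apply, Pi.add_apply, smul_eq_mul, Fin.mk_one]
        field_simp
        simp only [D, R]
        ring
  have hinf : atInfty φ = fun i => MvPolynomial.eval a (f i) :=
    funext fun i => (natDegree_aeval_line_le (hf i) a b).2
  have hat : ∀ t, evalAt φ t = fun i => MvPolynomial.eval (t • a + b) (f i) :=
    fun t => funext fun i => hev (f i) t
  have hφ : IsParam φ := by
    refine ⟨fun i => (natDegree_aeval_line_le (hf i) a b).1, ?_⟩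
    rw [Fintype.linearIndependent_iff] at hli ⊢
    intro c hc
    apply hli c
    have hg : (∑ i, c i • f i).IsHomogeneous n :=
      MvPolynomial.IsHomogeneous.sum _ _ _ fun i _ => by
        rw [MvPolynomial.smul_eq_C_mul]
        exact (hf i).C_mul _
    have hc' : MvPolynomial.aeval (fun k => C (a k) * X + C (b k)) (∑ i, c i • f i) = 0 := by
      rw [map_sum, ← hc]
      simp [φ]
    refine MvPolynomial.funext fun v => ?_
    rw [map_zero]
    rcases hvec v with ⟨r, t, rfl⟩ | ⟨r, rfl⟩
    · rw [eval_smul_of_isHomogeneous hg, ← hev, hc', eval_zero, mul_zero]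
    · rw [eval_smul_of_isHomogeneous hg, ← (natDegree_aeval_line_le hg a b).2, hc', coeff_zero,
        mul_zero]
  refine ⟨φ, hφ, ?_, ?_⟩
  · ext Q
    constructor
    · rintro ⟨v, hv, hne, rfl⟩
      rw [mk_mem_curve_iff]
      rcases hvec v with ⟨r, t, rfl⟩ | ⟨r, rfl⟩
      · refine Or.inl ⟨t, r ^ n, ?_⟩
        funext i
        rw [hat, eval_smul_of_isHomogeneous (hf i)]
        rfl
      · refine Or.inr ⟨r ^ n, ?_⟩
        funext i
        rw [hinf, eval_smul_of_isHomogeneous (hf i)]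
        rfl
    · rintro (⟨t, s, h⟩ | ⟨s, h⟩)
      · refine ⟨t • a + b, fun h0 => hdet ?_, ?_, ?_⟩
        · have e0 := congrFun h0 0
          have e1 := congrFun h0 1
          simp only [Pi.add_apply, Pi.smul_apply, smul_eq_mul, Pi.zero_apply] at e0 e1
          linear_combination (a 0) * e1 - (a 1) * e0
        · rw [← hat]
          exact hφ.evalAt_ne_zero t
        · conv_lhs => rw [← Q.mk_rep]
          exact (Projectivization.mk_eq_mk_iff' ℂ _ _ _ _).2 ⟨s, by rw [h, hat]⟩
      · refine ⟨a, ha, hfa, ?_⟩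
        conv_lhs => rw [← Q.mk_rep]
        exact (Projectivization.mk_eq_mk_iff' ℂ _ _ _ _).2 ⟨s, by rw [h, hinf]⟩
  · rw [hinf]
    obtain ⟨s, hs⟩ := (Projectivization.mk_eq_mk_iff' ℂ _ _ _ _).1 hPa.symm
    exact ⟨s, hs.symm⟩

end Parametrizations

end SecantRNC

/-! ### Secant spaces and the multiplication operator of a parametrization -/

namespace SecantRNC

section Secants

open Matrix Polynomial

variable {n : ℕ} {φ : Fin (n + 1) → ℂ[X]}

lemma IsParam.dotProduct_atInfty_eq_zero (hφ : IsParam φ) {v w : Fin (n + 1) → ℂ}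
    (h : pull φ w = X * pull φ v) : v ⬝ᵥ atInfty φ = 0 := by
  rw [← coeff_pull, ← coeff_X_mul, ← h]
  exact coeff_eq_zero_of_natDegree_lt (Nat.lt_succ_of_le (hφ.natDegree_pull_le w))

/-- The linear forms `ε k` span the forms that vanish at the point at infinity, and multiplication
by the parameter carries them to the forms `T k`. The cone over the curve is a determinantal variety
given by `ε` and `T`: it consists of the vectors at which the two tuples of forms take proportional
values. -/
lemma IsParam.inCone_iff (hφ : IsParam φ) {ε T : Fin n → Fin (n + 1) → ℂ}
    (hε : LinearIndependent ℂ ε) (hT : ∀ k, pull φ (T k) = X * pull φ (ε k))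
    (x : Fin (n + 1) → ℂ) :
    InCone φ x ↔ ∃ s t : ℂ, (s ≠ 0 ∨ t ≠ 0) ∧ ∀ k, s * (T k ⬝ᵥ x) = t * (ε k ⬝ᵥ x) := by
  have hinf : ∀ k, ε k ⬝ᵥ atInfty φ = 0 := fun k => hφ.dotProduct_atInfty_eq_zero (hT k)
  have hTt : ∀ t k, T k ⬝ᵥ evalAt φ t = t * (ε k ⬝ᵥ evalAt φ t) := by
    intro t k
    rw [← eval_pull, hT, eval_mul, eval_X, eval_pull]
  constructor
  · rintro (⟨t, s, rfl⟩ | ⟨s, rfl⟩)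
    · refine ⟨1, t, Or.inl one_ne_zero, fun k => ?_⟩
      simp only [dotProduct_smul, smul_eq_mul, hTt]
      ring
    · exact ⟨0, 1, Or.inr one_ne_zero, fun k => by simp [dotProduct_smul, hinf]⟩
  · rintro ⟨s, t, hst, h⟩
    rcases eq_or_ne s 0 with rfl | hs
    · have ht : t ≠ 0 := by simpa using hst
      refine Or.inr (exists_eq_smul_of_orthogonal hε hφ.atInfty_ne_zero hinf fun k => ?_)
      have := h k
      rw [zero_mul] at this
      exact (mul_eq_zero.1 this.symm).resolve_left ht
    · refine Or.inl ⟨t / s, ?_⟩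
      have hli : LinearIndependent ℂ fun k => T k - (t / s) • ε k := by
        rw [Fintype.linearIndependent_iff] at hε ⊢
        intro g hg
        apply hε
        rw [← hφ.pull_eq_zero_iff]
        have h1 := congrArg (pull φ) hg
        have h2 : (X - C (t / s)) * pull φ (∑ k, g k • ε k) = 0 := by
          rw [← h1.trans (map_zero _)]
          simp only [map_sum, map_smul, map_sub, hT, Finset.mul_sum, smul_eq_C_mul]
          exact Finset.sum_congr rfl fun k _ => by ring
        exact (mul_eq_zero.1 h2).resolve_left (X_sub_C_ne_zero _)
      refine exists_eq_smul_of_orthogonal hli (hφ.evalAt_ne_zero (t / s)) (fun k => ?_) fun k => ?_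
      · simp [sub_dotProduct, smul_dotProduct, hTt]
      · rw [sub_dotProduct, smul_dotProduct, smul_eq_mul, sub_eq_zero, div_mul_eq_mul_div,
          eq_div_iff hs, mul_comm, h k]

lemma mk_mem_pts_iff (L : CodimTwoSpace n) {x : Fin (n + 1) → ℂ} (hx : x ≠ 0) :
    Projectivization.mk ℂ x hx ∈ L.pts ↔ x ∈ L.1 := by
  rw [CodimTwoSpace.pts, Set.mem_ofPred_eq, Projectivization.submodule_mk,
    Submodule.span_singleton_le_iff_mem]

/-- If `L` avoids the point at infinity, its intersection with the curve is parametrized by the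
common zeros of the pullbacks of the two equations of `L`. -/
lemma IsParam.ncard_pts_inter_curve (hφ : IsParam φ) (hn : 1 ≤ n) {L : CodimTwoSpace n}
    {e : Fin 2 → Fin (n + 1) → ℂ} (hL : ∀ x, x ∈ L.1 ↔ ∀ k, e k ⬝ᵥ x = 0)
    (hinf : atInfty φ ∉ L.1) :
    (L.pts ∩ curve φ).ncard = {t | ∀ k, (pull φ (e k)).eval t = 0}.ncard := by
  have himage : L.pts ∩ curve φ = (fun t => Projectivization.mk ℂ _ (hφ.evalAt_ne_zero t)) ''
      {t | ∀ k, (pull φ (e k)).eval t = 0} := by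
    ext Q
    constructor
    · rintro ⟨hQL, hQ⟩
      have hmem : Q.rep ∈ L.1 := by
        rwa [← Q.mk_rep, mk_mem_pts_iff] at hQL
      rcases hQ with ⟨t, s, h⟩ | ⟨s, h⟩
      · have hs : s ≠ 0 := by
          rintro rfl
          exact Q.rep_nonzero (by rw [h, zero_smul])
        rw [h, Submodule.smul_mem_iff _ hs, hL] at hmem
        refine ⟨t, fun k => by rw [eval_pull, hmem], ?_⟩
        conv_rhs => rw [← Q.mk_rep]
        exact (Projectivization.mk_eq_mk_iff' ℂ _ _ _ _).2
          ⟨s⁻¹, by rw [h, smul_smul, inv_mul_cancel₀ hs, one_smul]⟩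
      · have hs : s ≠ 0 := by
          rintro rfl
          exact Q.rep_nonzero (by rw [h, zero_smul])
        rw [h, Submodule.smul_mem_iff _ hs] at hmem
        exact absurd hmem hinf
    · rintro ⟨t, ht, rfl⟩
      refine ⟨(mk_mem_pts_iff L _).2 ((hL _).2 fun k => by rw [← eval_pull, ht]),
        (mk_mem_curve_iff _).2 (Or.inl ⟨t, 1, by rw [one_smul]⟩)⟩
  rw [himage, Set.ncard_image_of_injective]
  intro t t' h
  obtain ⟨s, hs⟩ := (Projectivization.mk_eq_mk_iff' ℂ _ _ _ _).1 h
  exact hφ.evalAt_eq_smul_iff hn hs.symm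

/-- A criterion for a linear space to be secant: in the pencil of hyperplanes through it there is
one whose pullback `h` vanishes at `n - 1` distinct finite parameters, and one with pullback
proportional to `X * h`. -/
lemma IsParam.isSecant (hφ : IsParam φ) (hn : 2 ≤ n) {L : CodimTwoSpace n}
    {e : Fin 2 → Fin (n + 1) → ℂ} (hL : ∀ x, x ∈ L.1 ↔ ∀ k, e k ⬝ᵥ x = 0) {a b x y r : ℂ}
    (hr : r ≠ 0) (hpull : pull φ (x • e 0 + y • e 1) = C r * (X * pull φ (a • e 0 + b • e 1)))
    (htest : rootsTest (n - 1) (pull φ (a • e 0 + b • e 1)) ≠ 0) : IsSecant L (curve φ) := by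
  set h := pull φ (a • e 0 + b • e 1) with hh
  have hc : h.coeff (n - 1) ≠ 0 := left_ne_zero_of_mul htest
  have h0 : h ≠ 0 := by rintro h0; simp [h0] at hc
  have hdeg : h.natDegree ≤ n - 1 := by
    have h1 := hφ.natDegree_pull_le (x • e 0 + y • e 1)
    rw [hpull, natDegree_C_mul hr, natDegree_X_mul h0] at h1
    omega
  have hXh : ∀ k, (X * h).coeff (k + 1) = h.coeff k := fun k => coeff_X_mul _ _
  have hinf : atInfty φ ∉ L.1 := by
    rw [hL]
    intro hk
    apply hc
    have h1 := coeff_pull φ (x • e 0 + y • e 1)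
    rw [hpull, coeff_C_mul, add_dotProduct, smul_dotProduct, smul_dotProduct, hk, hk,
      show n = n - 1 + 1 by omega, hXh] at h1
    simpa [hr] using h1
  rw [IsSecant, hφ.ncard_pts_inter_curve (by omega) hL hinf,
    ← ncard_roots_of_rootsTest_ne_zero hdeg htest]
  congr 1
  have e1 : h = C a * pull φ (e 0) + C b * pull φ (e 1) := by
    rw [hh, map_add, map_smul, map_smul, smul_eq_C_mul, smul_eq_C_mul]
  have e2 : C r * (X * h) = C x * pull φ (e 0) + C y * pull φ (e 1) := by
    rw [← hpull, map_add, map_smul, map_smul, smul_eq_C_mul, smul_eq_C_mul]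
  -- The two members of the pencil span it.
  have hdet : a * y - b * x ≠ 0 := by
    intro hdet
    have h1 : (C y - C b * C r * X) * h = C (a * y - b * x) * pull φ (e 0) := by
      simp only [C_sub, C_mul]
      linear_combination C y * e1 - C b * e2
    have h2 : (C a * C r * X - C x) * h = C (a * y - b * x) * pull φ (e 1) := by
      simp only [C_sub, C_mul]
      linear_combination C a * e2 - C x * e1
    rw [hdet, C_0, zero_mul, mul_eq_zero, or_iff_left h0] at h1 h2
    have h3 : b = 0 := by
      have h3 := congrArg (eval 0) h1
      have h4 := congrArg (eval 1) h1
      simp only [eval_sub, eval_mul, eval_C, eval_X, eval_zero] at h3 h4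
      exact (mul_eq_zero.1 (by linear_combination h3 - h4 : b * r = 0)).resolve_right hr
    have h4 : a = 0 := by
      have h3 := congrArg (eval 0) h2
      have h4 := congrArg (eval 1) h2
      simp only [eval_sub, eval_mul, eval_C, eval_X, eval_zero] at h3 h4
      exact (mul_eq_zero.1 (by linear_combination h4 - h3 : a * r = 0)).resolve_right hr
    exact h0 (by rw [e1, h3, h4]; simp)
  ext t
  simp only [Set.mem_ofPred_eq, Fin.forall_fin_two]
  have e1' := congrArg (eval t) e1
  have e2' := congrArg (eval t) e2
  simp only [eval_add, eval_mul, eval_C, eval_X] at e1' e2'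
  constructor
  · rintro ⟨h1, h2⟩
    rw [e1', h1, h2]
    simp
  · intro h1
    rw [h1] at e1' e2'
    constructor
    · refine (mul_eq_zero.1 ?_).resolve_left hdet
      linear_combination b * e2' - y * e1'
    · refine (mul_eq_zero.1 ?_).resolve_left hdet
      linear_combination x * e1' - a * e2'

/-- The structure of the pencil of hyperplanes through a secant space that avoids the point at
infinity: after removing the `n - 1` common zeros, it consists of the affine functions. So if the
pullback of a form `μ` of the pencil vanishes at infinity, then the pencil also contains a form
whose pullback is `X` times that of `μ`. -/
lemma IsParam.exists_pull_eq_X_mul (hφ : IsParam φ) (hn : 2 ≤ n) {L : CodimTwoSpace n}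
    {e : Fin 2 → Fin (n + 1) → ℂ} (hL : ∀ x, x ∈ L.1 ↔ ∀ k, e k ⬝ᵥ x = 0)
    (he : LinearIndependent ℂ e) (hinf : atInfty φ ∉ L.1) (hsec : IsSecant L (curve φ)) {a b : ℂ}
    (hab : (a • e 0 + b • e 1) ⬝ᵥ atInfty φ = 0) :
    ∃ x y : ℂ, pull φ (x • e 0 + y • e 1) = X * pull φ (a • e 0 + b • e 1) := by
  rw [IsSecant, hφ.ncard_pts_inter_curve (by omega) hL hinf] at hsec
  set Z := {t | ∀ k, (pull φ (e k)).eval t = 0} with hZ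
  have hfin : Z.Finite := Set.finite_of_ncard_ne_zero (by omega)
  rw [Set.ncard_eq_toFinset_card _ hfin] at hsec
  set h : ℂ[X] := ∏ t ∈ hfin.toFinset, (X - C t) with hh
  have hdeg : h.natDegree = n - 1 := by
    rw [hh, natDegree_finsetProd_X_sub_C_eq_card, hsec]
  have hmonic : h.Monic := monic_prod_of_monic _ _ fun t _ => monic_X_sub_C t
  have hdvd : ∀ k, h ∣ pull φ (e k) := by
    intro k
    refine Finset.prod_dvd_of_coprime (fun t _ t' _ htt => ?_) fun t ht => ?_
    · exact pairwise_coprime_X_sub_C Function.injective_id htt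
    · rw [dvd_iff_isRoot]
      exact (hfin.mem_toFinset.1 ht) k
  have hlin : ∀ k, ∃ α β : ℂ, pull φ (e k) = h * (C α * X + C β) := by
    intro k
    obtain ⟨q, hq⟩ := hdvd k
    have h1 := hφ.natDegree_pull_le (e k)
    rcases eq_or_ne q 0 with rfl | hq0
    · exact ⟨0, 0, by rw [hq]; simp⟩
    · rw [hq, natDegree_mul hmonic.ne_zero hq0, hdeg] at h1
      obtain ⟨α, β, rfl⟩ := exists_eq_X_add_C_of_natDegree_le_one (p := q) (by omega)
      exact ⟨α, β, hq⟩
  choose α β hαβ using hlin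
  have hpull : ∀ x y, pull φ (x • e 0 + y • e 1) =
      h * (C (x * α 0 + y * α 1) * X + C (x * β 0 + y * β 1)) := by
    intro x y
    rw [map_add, map_smul, map_smul, smul_eq_C_mul, smul_eq_C_mul, hαβ, hαβ]
    simp only [C_add, C_mul]
    ring
  have hzero : ∀ x y, x * α 0 + y * α 1 = 0 → x * β 0 + y * β 1 = 0 → x = 0 ∧ y = 0 := by
    intro x y h1 h2
    have h3 := hpull x y
    rw [h1, h2, C_0, zero_mul, add_zero, mul_zero, hφ.pull_eq_zero_iff] at h3
    exact LinearIndependent.pair_iff.1 (by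
      have : e = ![e 0, e 1] := by funext i; fin_cases i <;> rfl
      rwa [this] at he) x y h3
  have hΔ : α 0 * β 1 - α 1 * β 0 ≠ 0 := by
    intro hΔ
    obtain ⟨h1, h2⟩ := hzero (α 1) (-α 0) (by ring) (by linear_combination -hΔ)
    obtain ⟨h3, h4⟩ := hzero (β 1) (-β 0) (by linear_combination hΔ) (by ring)
    simp only [neg_eq_zero] at h2 h4
    have := hzero 1 1 (by rw [h1, h2]; ring) (by rw [h3, h4]; ring)
    exact one_ne_zero this.1
  have hab' : a * α 0 + b * α 1 = 0 := by
    rw [← coeff_pull, hpull, mul_add, coeff_add, ← mul_assoc, mul_comm h, mul_assoc, coeff_C_mul,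
      mul_comm h X, show n = n - 1 + 1 by omega, coeff_X_mul, ← hdeg, hmonic.coeff_natDegree,
      mul_comm h, coeff_C_mul,
      coeff_eq_zero_of_natDegree_lt (show h.natDegree < h.natDegree + 1 by omega)] at hab
    simpa using hab
  refine ⟨(a * β 0 + b * β 1) * β 1 / (α 0 * β 1 - α 1 * β 0),
    -((a * β 0 + b * β 1) * β 0) / (α 0 * β 1 - α 1 * β 0), ?_⟩
  rw [hpull, hpull, hab']
  have h1 : (a * β 0 + b * β 1) * β 1 / (α 0 * β 1 - α 1 * β 0) * α 0 +
      -((a * β 0 + b * β 1) * β 0) / (α 0 * β 1 - α 1 * β 0) * α 1 = a * β 0 + b * β 1 := by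
    rw [div_mul_eq_mul_div, div_mul_eq_mul_div, ← add_div, div_eq_iff hΔ]
    ring
  have h2 : (a * β 0 + b * β 1) * β 1 / (α 0 * β 1 - α 1 * β 0) * β 0 +
      -((a * β 0 + b * β 1) * β 0) / (α 0 * β 1 - α 1 * β 0) * β 1 = 0 := by
    rw [div_mul_eq_mul_div, div_mul_eq_mul_div, ← add_div, div_eq_iff hΔ]
    ring
  rw [h1, h2]
  simp only [C_0]
  ring

end Secants

/-! ### The curve defined by a multiplication operator -/

section Minors

open Matrix Polynomial

variable {n : ℕ}

/-- The rows `X * ε k - T k` of a matrix of linear polynomials. A parametrization for which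
multiplication by the parameter carries `ε k` to `T k` is in the kernel of this matrix. -/
noncomputable def pencil (ε T : Fin n → Fin (n + 1) → ℂ) : Fin n → Fin (n + 1) → ℂ[X] :=
  fun k i => X * C (ε k i) - C (T k i)

/-- The signed maximal minors of the pencil `X * ε - T`. -/
noncomputable def minorParam (ε T : Fin n → Fin (n + 1) → ℂ) (i : Fin (n + 1)) : ℂ[X] :=
  (-1) ^ (i : ℕ) * ((Matrix.of (pencil ε T)).submatrix id i.succAbove).det

lemma sum_mul_minorParam (ε T : Fin n → Fin (n + 1) → ℂ) (v : Fin (n + 1) → ℂ[X]) :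
    ∑ i, v i * minorParam ε T i = (Matrix.of (Fin.cons v (pencil ε T))).det := by
  rw [Matrix.det_succ_row_zero]
  refine Finset.sum_congr rfl fun i _ => ?_
  rw [minorParam, mul_left_comm, ← mul_assoc]
  rfl

/-- The minors are orthogonal to the rows, by Laplace expansion of a determinant with a repeated
row. -/
lemma pull_minorParam (ε T : Fin n → Fin (n + 1) → ℂ) (k : Fin n) :
    pull (minorParam ε T) (T k) = X * pull (minorParam ε T) (ε k) := by
  have h := sum_mul_minorParam ε T (pencil ε T k)
  have h0 : (Matrix.of (Fin.cons (pencil ε T k) (pencil ε T)) : Matrix _ _ ℂ[X]).det = 0 :=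
    Matrix.det_zero_of_row_eq (Fin.succ_ne_zero k).symm rfl
  rw [h0] at h
  rw [pull_apply, pull_apply, Finset.mul_sum, eq_comm, ← sub_eq_zero, ← Finset.sum_sub_distrib, ← h]
  refine Finset.sum_congr rfl fun i _ => ?_
  simp only [pencil, smul_eq_C_mul]
  ring

lemma natDegree_minorParam_le (ε T : Fin n → Fin (n + 1) → ℂ) (i : Fin (n + 1)) :
    (minorParam ε T i).natDegree ≤ n := by
  have h := natDegree_det_X_add_C_le ((Matrix.of ε).submatrix id i.succAbove)
    (-(Matrix.of T).submatrix id i.succAbove)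
  rw [Fintype.card_fin] at h
  have h1 : minorParam ε T i = C ((-1) ^ (i : ℕ)) *
      ((X : ℂ[X]) • ((Matrix.of ε).submatrix id i.succAbove).map C +
        (-(Matrix.of T).submatrix id i.succAbove).map C).det := by
    rw [minorParam]
    congr 1
    · simp
    · congr 1
      ext k j : 2
      simp [pencil, sub_eq_add_neg]
  rw [h1]
  exact (natDegree_C_mul_le _ _).trans h

/-- The value at `t` of the pullback of a form. -/
lemma dotProduct_evalAt_minorParam (ε T : Fin n → Fin (n + 1) → ℂ) (l : Fin (n + 1) → ℂ) (t : ℂ) :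
    l ⬝ᵥ evalAt (minorParam ε T) t =
      (Matrix.of (Fin.cons l fun k => t • ε k - T k) : Matrix _ _ ℂ).det := by
  rw [← eval_pull]
  have h := sum_mul_minorParam ε T (fun i => C (l i))
  have h1 : pull (minorParam ε T) l = ∑ i, C (l i) * minorParam ε T i := by
    simp [pull_apply, smul_eq_C_mul]
  rw [h1, h, ← coe_evalRingHom, RingHom.map_det]
  congr 1
  ext i j
  refine Fin.cases ?_ (fun k => ?_) i
  · exact eval_C
  · change eval t (pencil ε T k j) = (t • ε k - T k) j
    simp only [pencil, eval_sub, eval_mul, eval_X, eval_C, Pi.sub_apply, Pi.smul_apply, smul_eq_mul]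

end Minors

end SecantRNC

/-! ### The linear system for the multiplication operator -/

namespace SecantRNC

section System

open Matrix Polynomial

variable {n q l : ℕ}

/-- Forms that vanish at `P`; a basis of the space of such forms if the last coordinate of `P` does
not vanish. -/
def formsAt (P : Fin (n + 1) → ℂ) (k : Fin n) : Fin (n + 1) → ℂ :=
  P (Fin.last n) • Pi.single k.castSucc 1 - P k.castSucc • Pi.single (Fin.last n) 1

/-- The member of the pencil spanned by the forms `e 0` and `e 1` that vanishes at `P`. -/
def memberAt (P : Fin (n + 1) → ℂ) (e : Fin 2 → Fin (n + 1) → ℂ) : Fin (n + 1) → ℂ :=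
  (e 1 ⬝ᵥ P) • e 0 + (-(e 0 ⬝ᵥ P)) • e 1

lemma formsAt_dotProduct (P x : Fin (n + 1) → ℂ) (k : Fin n) :
    formsAt P k ⬝ᵥ x = P (Fin.last n) * x k.castSucc - P k.castSucc * x (Fin.last n) := by
  simp [formsAt, sub_dotProduct, smul_dotProduct]

lemma formsAt_dotProduct_self (P : Fin (n + 1) → ℂ) (k : Fin n) : formsAt P k ⬝ᵥ P = 0 := by
  rw [formsAt_dotProduct]
  ring

lemma memberAt_dotProduct_self (P : Fin (n + 1) → ℂ) (e : Fin 2 → Fin (n + 1) → ℂ) :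
    memberAt P e ⬝ᵥ P = 0 := by
  simp only [memberAt, add_dotProduct, smul_dotProduct, smul_eq_mul]
  ring

lemma sum_smul_formsAt_castSucc (P : Fin (n + 1) → ℂ) (g : Fin n → ℂ) (k : Fin n) :
    (∑ k, g k • formsAt P k) k.castSucc = P (Fin.last n) * g k := by
  rw [Finset.sum_apply, Finset.sum_eq_single k]
  · simp [formsAt, (Fin.castSucc_lt_last k).ne, mul_comm]
  · intro k' _ hk
    have : k.castSucc ≠ k'.castSucc := fun h => hk (Fin.castSucc_injective _ h).symm
    simp [formsAt, (Fin.castSucc_lt_last k).ne, this]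
  · simp

lemma sum_smul_formsAt_last (P : Fin (n + 1) → ℂ) (g : Fin n → ℂ) :
    (∑ k, g k • formsAt P k) (Fin.last n) = -∑ k, g k * P k.castSucc := by
  rw [Finset.sum_apply, ← Finset.sum_neg_distrib]
  refine Finset.sum_congr rfl fun k _ => ?_
  simp [formsAt, (Fin.castSucc_lt_last k).ne']

lemma linearIndependent_formsAt {P : Fin (n + 1) → ℂ} (hP : P (Fin.last n) ≠ 0) :
    LinearIndependent ℂ (formsAt P) := by
  rw [Fintype.linearIndependent_iff]
  intro g hg k
  have := sum_smul_formsAt_castSucc P g k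
  rw [hg] at this
  exact (mul_eq_zero.1 this.symm).resolve_left hP

lemma sum_smul_formsAt {P μ : Fin (n + 1) → ℂ} (h : μ ⬝ᵥ P = 0) :
    ∑ k : Fin n, μ k.castSucc • formsAt P k = P (Fin.last n) • μ := by
  funext m
  refine Fin.lastCases ?_ (fun k => ?_) m
  · rw [sum_smul_formsAt_last, Pi.smul_apply, smul_eq_mul]
    rw [dotProduct, Fin.sum_univ_castSucc] at h
    linear_combination -h
  · rw [sum_smul_formsAt_castSucc, Pi.smul_apply, smul_eq_mul]

lemma memberAt_ne_zero {P : Fin (n + 1) → ℂ} {e : Fin 2 → Fin (n + 1) → ℂ}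
    (he : LinearIndependent ℂ e) (hP : ¬ ∀ k, e k ⬝ᵥ P = 0) : memberAt P e ≠ 0 := by
  intro h
  apply hP
  have he' : LinearIndependent ℂ ![e 0, e 1] := by
    have : e = ![e 0, e 1] := by funext i; fin_cases i <;> rfl
    rwa [this] at he
  obtain ⟨h1, h0⟩ := LinearIndependent.pair_iff.1 he' _ _ h
  rw [Fin.forall_fin_two]
  exact ⟨neg_eq_zero.1 h0, h1⟩

/-- The unknowns of the linear system: the coefficients of the images of the forms `formsAt P k`
under the multiplication operator; for every linear space, the coefficients, with respect to the two
equations, of the image of the member of the pencil that vanishes at `P`; the parameters of the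
points other than `P`. -/
abbrev Unknown (n q l : ℕ) : Type := (Fin n × Fin (n + 1)) ⊕ (Fin l × Fin 2) ⊕ Fin q

/-- The images of the forms `formsAt P k` under the multiplication operator. -/
def opForms (x : Unknown n q l → ℂ) (k : Fin n) : Fin (n + 1) → ℂ := fun m => x (Sum.inl (k, m))

/-- The parameters of the points other than the point at infinity. -/
def param (x : Unknown n q l → ℂ) (i : Fin q) : ℂ := x (Sum.inr (Sum.inr i))

/-- The form in the pencil of the `j`-th linear space with the coefficients given by `x`. -/
def opMember (c : CoordIndex n (q + 1) l → ℂ) (x : Unknown n q l → ℂ) (j : Fin l) :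
    Fin (n + 1) → ℂ :=
  x (Sum.inr (Sum.inl (j, 0))) • eqn c j 0 + x (Sum.inr (Sum.inl (j, 1))) • eqn c j 1

/-- `x` describes a linear map from the forms that vanish at the first point `P` to all forms, such
that the pencils of the linear spaces are preserved and the other points are eigenvectors of the
transpose. Multiplication by the parameter on a rational normal curve that solves the problem and
has `P` at infinity is such a map; another one is the inclusion. -/
structure IsOperator (c : CoordIndex n (q + 1) l → ℂ) (x : Unknown n q l → ℂ) : Prop where
  space : ∀ j, ∑ k : Fin n, memberAt (pt c 0) (eqn c j) k.castSucc • opForms x k = opMember c x j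
  point : ∀ i k, opForms x k ⬝ᵥ pt c i.succ = param x i * (formsAt (pt c 0) k ⬝ᵥ pt c i.succ)

/-- The inclusion of the forms that vanish at `P` into all forms. -/
def inclusion (c : CoordIndex n (q + 1) l → ℂ) : Unknown n q l → ℂ :=
  Sum.elim (fun km => formsAt (pt c 0) km.1 km.2)
    (Sum.elim (fun jk => pt c 0 (Fin.last n) *
      ![eqn c jk.1 1 ⬝ᵥ pt c 0, -(eqn c jk.1 0 ⬝ᵥ pt c 0)] jk.2) fun _ => 1)

lemma isOperator_inclusion (c : CoordIndex n (q + 1) l → ℂ) : IsOperator c (inclusion c) where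
  space j := by
    refine (sum_smul_formsAt (memberAt_dotProduct_self _ _)).trans ?_
    simp only [memberAt, opMember, inclusion, Sum.elim_inr, Sum.elim_inl, Matrix.cons_val_zero,
      Matrix.cons_val_one, smul_add, smul_smul]
  point i k := (one_mul _).symm

lemma IsOperator.add_smul {c : CoordIndex n (q + 1) l → ℂ} {x y : Unknown n q l → ℂ}
    (hx : IsOperator c x) (hy : IsOperator c y) (r : ℂ) : IsOperator c (x + r • y) where
  space j := by
    have h1 : ∀ k, opForms (x + r • y) k = opForms x k + r • opForms y k := fun k => rfl
    have h2 : opMember c (x + r • y) j = opMember c x j + r • opMember c y j := by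
      simp only [opMember, Pi.add_apply, Pi.smul_apply, smul_eq_mul]
      module
    rw [h2, ← hx.space, ← hy.space, Finset.smul_sum, ← Finset.sum_add_distrib]
    refine Finset.sum_congr rfl fun k _ => ?_
    rw [h1, smul_add, smul_comm]
  point i k := by
    have h1 : opForms (x + r • y) k = opForms x k + r • opForms y k := rfl
    have h2 : param (x + r • y) i = param x i + r * param y i := rfl
    rw [h1, h2, add_dotProduct, smul_dotProduct, hx.point, hy.point, smul_eq_mul]
    ring

lemma IsOperator.pull_opMember {c : CoordIndex n (q + 1) l → ℂ} {x : Unknown n q l → ℂ}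
    (hx : IsOperator c x) {φ : Fin (n + 1) → ℂ[X]}
    (hφ : ∀ k, pull φ (opForms x k) = X * pull φ (formsAt (pt c 0) k)) (j : Fin l) :
    pull φ (opMember c x j) =
      C (pt c 0 (Fin.last n)) * (X * pull φ (memberAt (pt c 0) (eqn c j))) := by
  have h := congrArg (pull φ) (sum_smul_formsAt (memberAt_dotProduct_self (pt c 0) (eqn c j)))
  rw [map_smul, smul_eq_C_mul] at h
  rw [mul_left_comm, ← h, ← hx.space, map_sum, map_sum, Finset.mul_sum]
  refine Finset.sum_congr rfl fun k _ => ?_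
  rw [map_smul, map_smul, hφ, mul_smul_comm]

/-- A solution of the linear system for which the corresponding minors parametrize a rational normal
curve gives a solution of the geometric problem, provided the zeros on the linear spaces are
distinct. -/
lemma IsOperator.isSolution (hn : 2 ≤ n) {δ : Datum n (q + 1) l}
    {c : CoordIndex n (q + 1) l → ℂ} (hc : δ.HasCoords c) (hP : pt c 0 (Fin.last n) ≠ 0)
    {x : Unknown n q l → ℂ} (hx : IsOperator c x) {φ : Fin (n + 1) → ℂ[X]} (hφ : IsParam φ)
    (hT : ∀ k, pull φ (opForms x k) = X * pull φ (formsAt (pt c 0) k))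
    (htest : ∀ j, rootsTest (n - 1) (pull φ (memberAt (pt c 0) (eqn c j))) ≠ 0) :
    δ.IsSolution (curve φ) := by
  have hε := linearIndependent_formsAt hP
  refine ⟨hφ.isRationalNormalCurve, fun i => ?_, fun j => ?_⟩
  · obtain ⟨h0, hi⟩ := hc.1 i
    rw [hi, mk_mem_curve_iff, hφ.inCone_iff hε hT]
    refine Fin.cases ?_ (fun i => ?_) i
    · exact ⟨0, 1, Or.inr one_ne_zero, fun k => by
        rw [zero_mul, one_mul]
        exact (formsAt_dotProduct_self (pt c 0) k).symm⟩
    · exact ⟨1, param x i, Or.inl one_ne_zero, fun k => by rw [one_mul]; exact hx.point i k⟩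
  · exact hφ.isSecant hn (mem_space_iff hc j) hP (hx.pull_opMember hT j) (htest j)

/-- A curve that solves the geometric problem gives a solution of the linear system. -/
lemma exists_isOperator_of_isSolution (hn : 2 ≤ n) {δ : Datum n (q + 1) l}
    {c : CoordIndex n (q + 1) l → ℂ} (hc : δ.HasCoords c)
    (hQ : ∀ i : Fin q, ∃ k, formsAt (pt c 0) k ⬝ᵥ pt c i.succ ≠ 0)
    (hL : ∀ j, ¬ ∀ k, eqn c j k ⬝ᵥ pt c 0 = 0) {S : Set (PSpace n)} (hS : δ.IsSolution S) :
    ∃ (φ : Fin (n + 1) → ℂ[X]) (x : Unknown n q l → ℂ), IsParam φ ∧ S = curve φ ∧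
      IsOperator c x ∧ ∀ k, pull φ (opForms x k) = X * pull φ (formsAt (pt c 0) k) := by
  obtain ⟨hrnc, hpt, hsec⟩ := hS
  obtain ⟨h0, hi⟩ := hc.1 0
  have hP0 := hpt 0
  rw [hi] at hP0
  obtain ⟨φ, hφ, rfl, s, hs⟩ := exists_isParam hrnc h0 hP0
  have hs0 : s ≠ 0 := by
    rintro rfl
    exact hφ.atInfty_ne_zero (by rw [hs, zero_smul])
  change atInfty φ = s • pt c 0 at hs
  have hperp : ∀ v, v ⬝ᵥ pt c 0 = 0 → ∃ w, pull φ w = X * pull φ v := by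
    intro v hv
    apply hφ.exists_pull_eq
    rcases eq_or_ne (pull φ v) 0 with h | h
    · simp [h]
    · rw [natDegree_X_mul h]
      refine Nat.succ_le_of_lt (lt_of_le_of_ne (hφ.natDegree_pull_le v) fun hd => ?_)
      have h1 := coeff_pull φ v
      rw [hs, dotProduct_smul, hv, smul_zero] at h1
      apply h
      rw [← leadingCoeff_eq_zero, leadingCoeff, hd, h1]
  choose T hT using fun k => hperp (formsAt (pt c 0) k) (formsAt_dotProduct_self _ _)
  have hinf : ∀ j, atInfty φ ∉ (δ.space j).1 := by
    intro j hj
    rw [hs, Submodule.smul_mem_iff _ hs0, mem_space_iff hc] at hj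
    exact hL j hj
  have hY : ∀ j, ∃ y : Fin 2 → ℂ, pull φ (y 0 • eqn c j 0 + y 1 • eqn c j 1) =
      X * pull φ (memberAt (pt c 0) (eqn c j)) := by
    intro j
    obtain ⟨x, y, h⟩ := hφ.exists_pull_eq_X_mul hn (mem_space_iff hc j) (linearIndependent_eqn hc j)
      (hinf j) (hsec j) (a := eqn c j 1 ⬝ᵥ pt c 0) (b := -(eqn c j 0 ⬝ᵥ pt c 0)) (by
        rw [hs, dotProduct_smul]
        exact (congrArg _ (memberAt_dotProduct_self (pt c 0) (eqn c j))).trans (smul_zero s))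
    exact ⟨![x, y], h⟩
  choose y hy using hY
  have hτ : ∀ i : Fin q, ∃ τ : ℂ, ∀ k, T k ⬝ᵥ pt c i.succ =
      τ * (formsAt (pt c 0) k ⬝ᵥ pt c i.succ) := by
    intro i
    obtain ⟨h1, h2⟩ := hc.1 i.succ
    have h3 := hpt i.succ
    rw [h2, mk_mem_curve_iff] at h3
    rcases h3 with ⟨t, r, h⟩ | ⟨r, h⟩
    · refine ⟨t, fun k => ?_⟩
      change pt c i.succ = _ at h
      rw [h, dotProduct_smul, dotProduct_smul, ← eval_pull, hT, eval_mul, eval_X, eval_pull,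
        smul_eq_mul, smul_eq_mul]
      ring
    · obtain ⟨k, hk⟩ := hQ i
      change pt c i.succ = _ at h
      rw [h, hs, dotProduct_smul, dotProduct_smul, formsAt_dotProduct_self] at hk
      simp at hk
  choose τ hτ using hτ
  refine ⟨φ, Sum.elim (fun km => T km.1 km.2)
    (Sum.elim (fun jk => pt c 0 (Fin.last n) * y jk.1 jk.2) τ), hφ, rfl, ⟨fun j => ?_, hτ⟩, hT⟩
  apply hφ.pull_injective
  have h1 := congrArg (pull φ) (sum_smul_formsAt (memberAt_dotProduct_self (pt c 0) (eqn c j)))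
  simp only [opMember, Sum.elim_inr, Sum.elim_inl, mul_smul, ← smul_add]
  rw [map_smul, hy, smul_eq_C_mul, mul_left_comm, ← smul_eq_C_mul, ← map_smul, ← h1, map_sum,
    map_sum, Finset.mul_sum]
  refine Finset.sum_congr rfl fun k _ => ?_
  rw [map_smul, map_smul, mul_smul_comm, ← hT]
  rfl

/-- The linear system for the operators, together with the vanishing of one coefficient, which
excludes the inclusion. It has one equation less than unknowns if `q + l = n + 2`. -/
def system [NeZero n] (c : CoordIndex n (q + 1) l → ℂ) : (Unknown n q l → ℂ) →ₗ[ℂ]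
    ((Fin l × Fin (n + 1)) ⊕ (Fin q × Fin n) ⊕ Unit → ℂ) where
  toFun x := Sum.elim
    (fun jm => (∑ k : Fin n, memberAt (pt c 0) (eqn c jm.1) k.castSucc • opForms x k) jm.2 -
      opMember c x jm.1 jm.2)
    (Sum.elim (fun ik => opForms x ik.2 ⬝ᵥ pt c ik.1.succ -
      param x ik.1 * (formsAt (pt c 0) ik.2 ⬝ᵥ pt c ik.1.succ)) fun _ => opForms x 0 0)
  map_add' x y := by
    funext e
    rcases e with ⟨j, m⟩ | ⟨i, k⟩ | _
    · simp only [Sum.elim_inl, Finset.sum_apply, Pi.smul_apply, smul_eq_mul, opForms, opMember,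
        Pi.add_apply, mul_add, add_mul, Finset.sum_add_distrib]
      ring
    · simp only [Sum.elim_inl, Sum.elim_inr, opForms, param, Pi.add_apply, add_mul, dotProduct,
        Finset.sum_add_distrib]
      ring
    · rfl
  map_smul' r x := by
    funext e
    rcases e with ⟨j, m⟩ | ⟨i, k⟩ | _
    · simp only [Sum.elim_inl, Finset.sum_apply, Pi.smul_apply, smul_eq_mul, opForms, opMember,
        Pi.add_apply, RingHom.id_apply, mul_sub, mul_add, Finset.mul_sum, mul_assoc]
      simp only [mul_left_comm r]
    · simp only [Sum.elim_inl, Sum.elim_inr, opForms, param, Pi.smul_apply, smul_eq_mul, dotProduct,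
        RingHom.id_apply, mul_sub, Finset.mul_sum, mul_assoc]
    · rfl

lemma system_eq_zero_iff [NeZero n] (c : CoordIndex n (q + 1) l → ℂ) (x : Unknown n q l → ℂ) :
    system c x = 0 ↔ IsOperator c x ∧ opForms x 0 0 = 0 := by
  constructor
  · intro h
    exact ⟨⟨fun j => funext fun m => sub_eq_zero.1 (congrFun h (Sum.inl (j, m))),
      fun i k => sub_eq_zero.1 (congrFun h (Sum.inr (Sum.inl (i, k))))⟩,
      congrFun h (Sum.inr (Sum.inr ()))⟩
  · rintro ⟨⟨h1, h2⟩, h3⟩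
    funext e
    rcases e with ⟨j, m⟩ | ⟨i, k⟩ | _
    · exact sub_eq_zero.2 (congrFun (h1 j) m)
    · exact sub_eq_zero.2 (h2 i k)
    · exact h3

lemma isPolyFun_dotProduct {σ ι : Type*} [Fintype ι] {v w : (σ → ℂ) → ι → ℂ}
    (hv : ∀ i, IsPolyFun (fun c => v c i)) (hw : ∀ i, IsPolyFun (fun c => w c i)) :
    IsPolyFun (fun c => v c ⬝ᵥ w c) :=
  IsPolyFun.sum fun i _ => (hv i).mul (hw i)

lemma isPolyFun_pt {p : ℕ} (i : Fin p) (m : Fin (n + 1)) :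
    IsPolyFun (fun c : CoordIndex n p l → ℂ => pt c i m) := IsPolyFun.coord _

lemma isPolyFun_eqn {p : ℕ} (j : Fin l) (k : Fin 2) (m : Fin (n + 1)) :
    IsPolyFun (fun c : CoordIndex n p l → ℂ => eqn c j k m) := IsPolyFun.coord _

lemma isPolyFun_formsAt (k : Fin n) (m : Fin (n + 1)) :
    IsPolyFun (fun c : CoordIndex n (q + 1) l → ℂ => formsAt (pt c 0) k m) :=
  ((isPolyFun_pt _ _).mul (IsPolyFun.const _)).sub ((isPolyFun_pt _ _).mul (IsPolyFun.const _))

lemma isPolyFun_memberAt (j : Fin l) (m : Fin (n + 1)) :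
    IsPolyFun (fun c : CoordIndex n (q + 1) l → ℂ => memberAt (pt c 0) (eqn c j) m) :=
  ((isPolyFun_dotProduct (isPolyFun_eqn j 1) (isPolyFun_pt 0)).mul (isPolyFun_eqn j 0 m)).add
    ((isPolyFun_dotProduct (isPolyFun_eqn j 0) (isPolyFun_pt 0)).neg.mul (isPolyFun_eqn j 1 m))

lemma isPolyFun_system [NeZero n] (x : Unknown n q l → ℂ) (e) :
    IsPolyFun (fun c : CoordIndex n (q + 1) l → ℂ => system c x e) := by
  rcases e with ⟨j, m⟩ | ⟨i, k⟩ | _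
  · change IsPolyFun fun c : CoordIndex n (q + 1) l → ℂ =>
      (∑ k : Fin n, memberAt (pt c 0) (eqn c j) k.castSucc • opForms x k) m - opMember c x j m
    simp only [Finset.sum_apply, Pi.smul_apply, smul_eq_mul]
    exact (IsPolyFun.sum fun k _ => (isPolyFun_memberAt j _).mul (IsPolyFun.const _)).sub
      (((IsPolyFun.const _).mul (isPolyFun_eqn _ _ _)).add
        ((IsPolyFun.const _).mul (isPolyFun_eqn _ _ _)))
  · change IsPolyFun fun c : CoordIndex n (q + 1) l → ℂ => opForms x k ⬝ᵥ pt c i.succ -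
      param x i * (formsAt (pt c 0) k ⬝ᵥ pt c i.succ)
    exact (isPolyFun_dotProduct (v := fun _ => opForms x k) (fun _ => IsPolyFun.const _)
      (isPolyFun_pt _)).sub
      ((IsPolyFun.const _).mul (isPolyFun_dotProduct (isPolyFun_formsAt k) (isPolyFun_pt _)))
  · exact IsPolyFun.const _

/-- The determinant of the values of the minors at `0, …, n`, which detects their linear
independence. -/
def paramTest (ε T : Fin n → Fin (n + 1) → ℂ) : ℂ :=
  (Matrix.of fun i m : Fin (n + 1) =>
    (Matrix.of (Fin.cons (Pi.single i 1) fun k => ((m : ℕ) : ℂ) • ε k - T k) :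
      Matrix (Fin (n + 1)) (Fin (n + 1)) ℂ).det).det

lemma paramTest_ne_zero_iff (ε T : Fin n → Fin (n + 1) → ℂ) :
    paramTest ε T ≠ 0 ↔ IsParam (minorParam ε T) := by
  have hM : paramTest ε T =
      (Matrix.of fun i m : Fin (n + 1) => evalAt (minorParam ε T) ((m : ℕ) : ℂ) i).det := by
    rw [paramTest]
    congr 2
    funext i m
    rw [← dotProduct_evalAt_minorParam, single_one_dotProduct]
  have hvec : ∀ g : Fin (n + 1) → ℂ,
      g ᵥ* (Matrix.of fun i m : Fin (n + 1) => evalAt (minorParam ε T) ((m : ℕ) : ℂ) i) = 0 ↔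
        pull (minorParam ε T) g = 0 := by
    intro g
    have h1 : ∀ m, (g ᵥ* (Matrix.of fun i m : Fin (n + 1) =>
        evalAt (minorParam ε T) ((m : ℕ) : ℂ) i)) m =
          (pull (minorParam ε T) g).eval ((m : ℕ) : ℂ) := fun m => (eval_pull _ _ _).symm
    constructor
    · intro h
      refine eq_zero_of_natDegree_lt_card_of_eval_eq_zero (pull (minorParam ε T) g)
        (f := fun m : Fin (n + 1) => ((m : ℕ) : ℂ)) (fun a b hab => ?_) (fun m => ?_) ?_
      · exact Fin.ext (Nat.cast_injective hab)
      · rw [← h1, h]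
        rfl
      · rw [Fintype.card_fin, Nat.lt_succ_iff, pull_apply]
        exact natDegree_sum_le_of_forall_le _ _ fun i _ =>
          (natDegree_smul_le _ _).trans (natDegree_minorParam_le ε T i)
    · intro h
      funext m
      rw [h1, h]
      simp
  rw [hM, ne_eq, ← Matrix.exists_vecMul_eq_zero_iff]
  constructor
  · intro h
    refine ⟨natDegree_minorParam_le ε T, Fintype.linearIndependent_iff.2 fun g hg => ?_⟩
    by_contra hne
    exact h ⟨g, fun h0 => hne (by simp [h0]), (hvec g).2 hg⟩
  · rintro h ⟨g, hg, h0⟩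
    exact hg (h.pull_eq_zero_iff.1 ((hvec g).1 h0))

lemma isPolyFun_paramTest {σ : Type*} {ε T : (σ → ℂ) → Fin n → Fin (n + 1) → ℂ}
    (hε : ∀ k m, IsPolyFun fun c => ε c k m) (hT : ∀ k m, IsPolyFun fun c => T c k m) :
    IsPolyFun (fun c => paramTest (ε c) (T c)) := by
  refine IsPolyFun.det fun i m => IsPolyFun.det fun a b => ?_
  refine Fin.cases ?_ (fun k => ?_) a
  · exact IsPolyFun.const _
  · exact ((IsPolyFun.const _).mul (hε k b)).sub (hT k b)

lemma isPolyFamily_pull_minorParam {σ : Type*} {ε T : (σ → ℂ) → Fin n → Fin (n + 1) → ℂ}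
    {v : (σ → ℂ) → Fin (n + 1) → ℂ} (hε : ∀ k m, IsPolyFun fun c => ε c k m)
    (hT : ∀ k m, IsPolyFun fun c => T c k m) (hv : ∀ m, IsPolyFun fun c => v c m) :
    IsPolyFamily (fun c => pull (minorParam (ε c) (T c)) (v c)) := by
  simp only [pull_apply, smul_eq_C_mul, minorParam]
  refine IsPolyFamily.sum fun i _ => (IsPolyFamily.C (hv i)).mul
    ((IsPolyFamily.const _).mul (IsPolyFamily.det fun a b => ?_))
  exact ((IsPolyFamily.const _).mul (IsPolyFamily.C (hε _ _))).sub (IsPolyFamily.C (hT _ _))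

/-- The nondegeneracy conditions on a solution of the linear system under which it defines a
solution of the geometric problem. -/
structure IsGood (c : CoordIndex n (q + 1) l → ℂ) (x : Unknown n q l → ℂ) : Prop where
  param : paramTest (formsAt (pt c 0)) (opForms x) ≠ 0
  roots : ∀ j, rootsTest (n - 1) (pull (minorParam (formsAt (pt c 0)) (opForms x))
    (memberAt (pt c 0) (eqn c j))) ≠ 0

/-- Reduction of generic existence and uniqueness to examples: one where the linear system has only
one solution up to scalars, and, given any nonempty open condition that is satisfied there, one
where this condition holds and the solutions of the linear system are nondegenerate. -/
lemma generically_existsUnique_of_example [NeZero n] (hn : 2 ≤ n) (hql : q + l = n + 2)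
    (c₀ : CoordIndex n (q + 1) l → ℂ) (u : Unknown n q l)
    (h₀ : ∀ x, system c₀ x = 0 → x u = 0 → x = 0)
    (hgood : ∀ D : (CoordIndex n (q + 1) l → ℂ) → ℂ, IsPolyFun D → D c₀ ≠ 0 →
      ∃ (δ : Datum n (q + 1) l) (c : _), δ.HasCoords c ∧ D c ≠ 0 ∧ pt c 0 (Fin.last n) ≠ 0 ∧
        (∀ i : Fin q, formsAt (pt c 0) 0 ⬝ᵥ pt c i.succ ≠ 0) ∧
        ∀ x, x ≠ 0 → (∀ y, system c y = 0 → ∃ s : ℂ, y = s • x) → IsGood c x) :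
    Generically (fun δ : Datum n (q + 1) l => ∃! S : Set (PSpace n), δ.IsSolution S) := by
  have hcard : Fintype.card (Unknown n q l) =
      Fintype.card ((Fin l × Fin (n + 1)) ⊕ (Fin q × Fin n) ⊕ Unit) + 1 := by
    simp only [Fintype.card_sum, Fintype.card_prod, Fintype.card_fin, Fintype.card_unit]
    have h1 : (q + l) * n = (n + 2) * n := by rw [hql]
    nlinarith
  obtain ⟨D, w, hD, hw, hD₀, hsys, hker⟩ :=
    exists_polynomial_kernel hcard system isPolyFun_system c₀ u h₀
  let ε : (CoordIndex n (q + 1) l → ℂ) → Fin n → Fin (n + 1) → ℂ := fun c => formsAt (pt c 0)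
  let T : (CoordIndex n (q + 1) l → ℂ) → Fin n → Fin (n + 1) → ℂ := fun c => opForms (w c)
  let μ : (CoordIndex n (q + 1) l → ℂ) → Fin l → Fin (n + 1) → ℂ :=
    fun c j => memberAt (pt c 0) (eqn c j)
  have hε : ∀ k m, IsPolyFun fun c => ε c k m := fun k m => isPolyFun_formsAt k m
  have hT : ∀ k m, IsPolyFun fun c => T c k m := fun k m => hw _
  refine generically_of_isPolyFun (F := fun c => D c * (pt c 0 (Fin.last n) *
    ((∏ i : Fin q, ε c 0 ⬝ᵥ pt c i.succ) * (paramTest (ε c) (T c) *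
      ∏ j, rootsTest (n - 1) (pull (minorParam (ε c) (T c)) (μ c j)))))) ?_ ?_ ?_
  · refine hD.mul ((isPolyFun_pt _ _).mul ((IsPolyFun.prod fun i _ => ?_).mul
      ((isPolyFun_paramTest hε hT).mul (IsPolyFun.prod fun j _ => ?_))))
    · exact isPolyFun_dotProduct (hε 0) (isPolyFun_pt _)
    · exact (isPolyFamily_pull_minorParam hε hT (isPolyFun_memberAt j)).rootsTest _
  · obtain ⟨δ, c, hc, hDc, hP, hQ, hg⟩ := hgood D hD hD₀
    obtain ⟨hg1, hg2⟩ := hg (w c) (hker c hDc).1 (hker c hDc).2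
    exact ⟨δ, c, hc, mul_ne_zero hDc (mul_ne_zero hP (mul_ne_zero
      (Finset.prod_ne_zero_iff.2 fun i _ => hQ i) (mul_ne_zero hg1
        (Finset.prod_ne_zero_iff.2 fun j _ => hg2 j))))⟩
  · intro δ c hc hF
    simp only [mul_ne_zero_iff, Finset.prod_ne_zero_iff] at hF
    obtain ⟨hDc, hP, hQ, hparam, hroots⟩ := hF
    have hφ := (paramTest_ne_zero_iff _ _).1 hparam
    have hop := ((system_eq_zero_iff c (w c)).1 (hsys c)).1
    have hpull : ∀ k, pull (minorParam (ε c) (T c)) (T c k) =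
        X * pull (minorParam (ε c) (T c)) (ε c k) := pull_minorParam (ε c) (T c)
    have hε' : LinearIndependent ℂ (ε c) := linearIndependent_formsAt hP
    refine ⟨curve (minorParam (ε c) (T c)),
      hop.isSolution hn hc hP hφ hpull fun j => hroots j (Finset.mem_univ j), fun S hS => ?_⟩
    obtain ⟨φ, x, hφ', rfl, hx, hpull'⟩ := exists_isOperator_of_isSolution hn hc
      (fun i => ⟨0, hQ i (Finset.mem_univ i)⟩) (fun j h => by
        apply hroots j (Finset.mem_univ j)
        have : μ c j = 0 := by simp [μ, memberAt, h]
        simp [this, rootsTest]) hS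
    -- Subtracting a multiple of the inclusion, one obtains a solution of the full system.
    set r := opForms x 0 0 / pt c 0 (Fin.last n) with hr
    obtain ⟨s, hs⟩ := (hker c hDc).2 (x + (-r) • inclusion c) ((system_eq_zero_iff _ _).2
      ⟨hx.add_smul (isOperator_inclusion c) _, by
        change opForms x 0 0 + -r * formsAt (pt c 0) 0 0 = 0
        have h1 : formsAt (pt c 0) 0 0 = pt c 0 (Fin.last n) := by
          have h2 : (0 : Fin (n + 1)) = (0 : Fin n).castSucc := rfl
          have h3 : (0 : Fin n).castSucc ≠ Fin.last n := (Fin.castSucc_lt_last _).ne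
          rw [h2, formsAt]
          simp only [Pi.sub_apply, Pi.smul_apply, Pi.single_eq_same, Pi.single_eq_of_ne h3,
            smul_eq_mul]
          ring
        rw [h1, hr, neg_mul, div_mul_cancel₀ _ hP, add_neg_cancel]⟩)
    have hxw : ∀ k, opForms x k = s • T c k + r • ε c k := by
      intro k
      funext m
      have := congrFun hs (Sum.inl (k, m))
      change x (Sum.inl (k, m)) + -r * ε c k m = s * T c k m at this
      change x (Sum.inl (k, m)) = s * T c k m + r * ε c k m
      linear_combination this
    have hs0 : s ≠ 0 := by
      rintro rfl
      have h1 := hpull' 0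
      rw [hxw, zero_smul, zero_add, map_smul, smul_eq_C_mul, ← sub_eq_zero, ← sub_mul] at h1
      have h2 := (mul_eq_zero.1 h1).resolve_left (sub_ne_zero.2 (X_ne_C r).symm)
      exact hε'.ne_zero 0 (hφ'.pull_eq_zero_iff.1 h2)
    ext Q
    change InCone φ Q.rep ↔ InCone _ Q.rep
    rw [hφ'.inCone_iff hε' hpull', hφ.inCone_iff hε' hpull]
    simp only [hxw, add_dotProduct, smul_dotProduct, smul_eq_mul]
    constructor
    · rintro ⟨a, b, hab, h⟩
      refine ⟨a * s, b - a * r, ?_, fun k => by linear_combination h k⟩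
      rcases eq_or_ne a 0 with rfl | ha
      · right
        simpa using hab
      · exact Or.inl (mul_ne_zero ha hs0)
    · rintro ⟨a, b, hab, h⟩
      refine ⟨a / s, b + a / s * r, ?_, fun k => ?_⟩
      · rcases eq_or_ne a 0 with rfl | ha
        · right
          simpa using hab
        · exact Or.inl (div_ne_zero ha hs0)
      · have h1 := h k
        have h2 : a / s * s = a := div_mul_cancel₀ _ hs0
        linear_combination h1 + h2 * (T c k ⬝ᵥ Q.rep)

end System

end SecantRNC

/-! ### Operators that preserve special pencils and eigenvectors -/

namespace SecantRNC

section Rigidity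

open Polynomial

/-- The coefficients of a vanishing combination of affine multiples of monomials. -/
lemma coeff_sum_linear_mul_X_pow {n : ℕ} (A B : ℕ → ℂ)
    (h : ∑ k ∈ Finset.range n, (C (A k) + C (B k) * X) * X ^ k = 0) :
    (0 < n → A 0 = 0) ∧ (∀ k, k + 1 < n → A (k + 1) + B k = 0) ∧ ∀ k, k + 1 = n → B k = 0 := by
  have h' : ∑ k ∈ Finset.range n, (C (A k) * X ^ k + C (B k) * X ^ (k + 1)) = 0 := by
    rw [← h]
    exact Finset.sum_congr rfl fun k _ => by ring
  have hc : ∀ m, ∑ k ∈ Finset.range n, ((if m = k then A k else 0) +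
      if m = k + 1 then B k else 0) = 0 := by
    intro m
    have := congrArg (fun g => coeff g m) h'
    simpa [coeff_X_pow] using this
  refine ⟨fun hn => ?_, fun k hk => ?_, ?_⟩
  · have := hc 0
    simpa [Finset.sum_add_distrib, hn] using this
  · have := hc (k + 1)
    simpa [Finset.sum_add_distrib, hk, (Nat.lt_succ_self k).trans hk] using this
  · rintro k rfl
    have := hc (k + 1)
    simpa [Finset.sum_add_distrib] using this

/-- The coefficients of the polynomials of degree less than `n` that define the linear spaces of an
example: the monomials for `j < n`, the geometric series for `j = n`, and its image under scaling
the variable by `2` for `j = n + 1`. -/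
def exampleCoeff (n j k : ℕ) : ℂ :=
  if j < n then (if k = j then 1 else 0) else if j = n then 1 else 2 ^ k

/-- Let `h j` be the polynomial with coefficients `exampleCoeff n j`. Consider a linear map from
polynomials of degree less than `n` to polynomials of degree at most `n`, which sends `X ^ k` to
`s k`. If it sends `h j` into the span of `h j` and `X * h j` for `j < l`, and evaluation at `i + 2`
is an eigenvector of its transpose for `i < q`, then it is multiplication by an affine function. -/
lemma exists_eq_affine_mul {n q l : ℕ} (hn : 2 ≤ n) (hql : q + l = n + 2) (hl : l ≤ 1 ∨ n ≤ l)
    (s : ℕ → ℂ[X]) (hs : ∀ k < n, (s k).natDegree ≤ n)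
    (hspace : ∀ j < l, ∃ a b : ℂ, ∑ k ∈ Finset.range n, C (exampleCoeff n j k) * s k =
      (C a + C b * X) * ∑ k ∈ Finset.range n, C (exampleCoeff n j k) * X ^ k)
    (hpoint : ∀ i < q, ∃ σ : ℂ, ∀ k < n, (s k).eval ((i : ℂ) + 2) = σ * ((i : ℂ) + 2) ^ k) :
    ∃ α β : ℂ, ∀ k < n, s k = (C α + C β * X) * X ^ k := by
  have hmono : ∀ j < l, j < n → ∃ a b : ℂ, s j = (C a + C b * X) * X ^ j := by
    intro j hj hjn
    obtain ⟨a, b, h⟩ := hspace j hj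
    refine ⟨a, b, ?_⟩
    simpa [exampleCoeff, hjn, apply_ite C, ite_mul] using h
  -- A polynomial of degree at most `n` cannot vanish at `n + 1` of the points.
  have hzero : ∀ (g : ℂ[X]) (I : Finset ℕ), g.natDegree ≤ n → n < I.card →
      (∀ i ∈ I, g.eval ((i : ℂ) + 2) = 0) → g = 0 := by
    intro g I hg hI h
    have hinj : Function.Injective fun i : ℕ => (i : ℂ) + 2 := fun a b hab => by
      simpa using hab
    refine eq_zero_of_natDegree_lt_card_of_eval_eq_zero' g (I.image fun i : ℕ => (i : ℂ) + 2)
      (by simpa using h) ?_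
    rw [Finset.card_image_of_injective _ hinj]
    omega
  have hdeg : ∀ (α β : ℂ), ∀ k < n, (s k - (C α + C β * X) * X ^ k).natDegree ≤ n := by
    intro α β k hk
    refine (natDegree_sub_le _ _).trans (max_le (hs k hk) ?_)
    refine natDegree_mul_le.trans ?_
    rw [natDegree_X_pow]
    have : (C α + C β * X).natDegree ≤ 1 := by compute_degree
    omega
  rcases hl with hl | hl
  · obtain rfl | rfl : l = 0 ∨ l = 1 := by omega
    · obtain rfl : q = n + 2 := by omega
      choose! σ hσ using hpoint
      -- Subtract the affine function that has the eigenvalues at the last two points.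
      obtain ⟨α, β, h1, h2⟩ : ∃ α β : ℂ, σ n = α + β * ((n : ℂ) + 2) ∧
          σ (n + 1) = α + β * (((n + 1 : ℕ) : ℂ) + 2) :=
        ⟨σ n - (σ (n + 1) - σ n) * ((n : ℂ) + 2), σ (n + 1) - σ n, by ring, by push_cast; ring⟩
      have hev : ∀ i < n + 2, ∀ k < n, (s k - (C α + C β * X) * X ^ k).eval ((i : ℂ) + 2) =
          (σ i - (α + β * ((i : ℂ) + 2))) * ((i : ℂ) + 2) ^ k := by
        intro i hi k hk
        simp only [eval_sub, eval_mul, eval_add, eval_C, eval_X, eval_pow, hσ i hi k hk]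
        ring
      have hσ0 : ∀ i < n + 2, σ i - (α + β * ((i : ℂ) + 2)) = 0 := by
        intro i hi
        by_cases hin : i < n
        · set f : ℂ[X] := ∏ k ∈ (Finset.range n).erase i, (X - C ((k : ℂ) + 2)) with hf
          have hfd : f.natDegree < n := by
            rw [hf, natDegree_finsetProd_X_sub_C_eq_card,
              Finset.card_erase_of_mem (Finset.mem_range.2 hin), Finset.card_range]
            omega
          have hR : ∑ k ∈ Finset.range n, C (f.coeff k) * (s k - (C α + C β * X) * X ^ k) = 0 := by
            have hRev : ∀ i' < n + 2, (∑ k ∈ Finset.range n, C (f.coeff k) *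
                (s k - (C α + C β * X) * X ^ k)).eval ((i' : ℂ) + 2) =
                  (σ i' - (α + β * ((i' : ℂ) + 2))) * f.eval ((i' : ℂ) + 2) := by
              intro i' hi'
              rw [eval_finsetSum, eval_eq_sum_range' hfd, Finset.mul_sum]
              refine Finset.sum_congr rfl fun k hk => ?_
              rw [eval_mul, eval_C, hev i' hi' k (Finset.mem_range.1 hk)]
              ring
            refine hzero _ ((Finset.range (n + 2)).erase i) ?_ ?_ fun i' hi' => ?_
            · exact natDegree_sum_le_of_forall_le _ _ fun k hk =>
                (natDegree_C_mul_le _ _).trans (hdeg α β k (Finset.mem_range.1 hk))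
            · rw [Finset.card_erase_of_mem (Finset.mem_range.2 hi), Finset.card_range]
              omega
            · rw [Finset.mem_erase, Finset.mem_range] at hi'
              rw [hRev i' hi'.2]
              by_cases hin' : i' < n
              · have : f.eval ((i' : ℂ) + 2) = 0 := by
                  rw [hf, eval_prod]
                  exact Finset.prod_eq_zero (Finset.mem_erase.2 ⟨hi'.1, Finset.mem_range.2 hin'⟩)
                    (by simp)
                rw [this, mul_zero]
              · obtain rfl | rfl : i' = n ∨ i' = n + 1 := by omega
                · rw [h1, sub_self, zero_mul]
                · rw [h2, sub_self, zero_mul]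
          have hRi := congrArg (eval ((i : ℂ) + 2)) hR
          rw [eval_zero, eval_finsetSum] at hRi
          have hfi : f.eval ((i : ℂ) + 2) ≠ 0 := by
            rw [hf, eval_prod, Finset.prod_ne_zero_iff]
            intro k hk
            have := (Finset.mem_erase.1 hk).1
            simp only [eval_sub, eval_X, eval_C, add_sub_add_right_eq_sub, ne_eq, sub_eq_zero,
              Nat.cast_inj]
            exact this.symm
          refine (mul_eq_zero.1 ?_).resolve_right hfi
          rw [eval_eq_sum_range' hfd, Finset.mul_sum, ← hRi]
          refine Finset.sum_congr rfl fun k hk => ?_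
          rw [eval_mul, eval_C, hev i hi k (Finset.mem_range.1 hk)]
          ring
        · obtain rfl | rfl : i = n ∨ i = n + 1 := by omega
          · rw [h1, sub_self]
          · rw [h2, sub_self]
      refine ⟨α, β, fun k hk => sub_eq_zero.1 (hzero _ (Finset.range (n + 2)) (hdeg α β k hk)
        (by rw [Finset.card_range]; omega) fun i hi => ?_)⟩
      rw [hev i (Finset.mem_range.1 hi) k hk, hσ0 i (Finset.mem_range.1 hi), zero_mul]
    · obtain ⟨a, b, h0⟩ := hmono 0 (by omega) (by omega)
      refine ⟨a, b, fun k hk => sub_eq_zero.1 (hzero _ (Finset.range (n + 1)) (hdeg a b k hk)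
        (by rw [Finset.card_range]; omega) fun i hi => ?_)⟩
      obtain ⟨σ, hσ⟩ := hpoint i (by have := Finset.mem_range.1 hi; omega)
      have h1 := hσ 0 (by omega)
      rw [h0] at h1
      simp only [eval_mul, eval_add, eval_C, eval_X, pow_zero, mul_one] at h1
      simp only [eval_sub, eval_mul, eval_add, eval_C, eval_X, eval_pow, hσ k hk, h1, sub_self]
  · have hmono' : ∀ j < n, ∃ a b : ℂ, s j = (C a + C b * X) * X ^ j :=
      fun j hj => hmono j (by omega) hj
    choose! a b hab using hmono'
    have heig : ∀ i < q, ∃ σ : ℂ, ∀ k < n, a k + b k * ((i : ℂ) + 2) = σ := by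
      intro i hi
      obtain ⟨σ, hσ⟩ := hpoint i hi
      refine ⟨σ, fun k hk => ?_⟩
      have h1 := hσ k hk
      rw [hab k hk] at h1
      simp only [eval_mul, eval_add, eval_C, eval_X, eval_pow] at h1
      have h2 : ((i : ℂ) + 2) ^ k ≠ 0 := by
        have : ((i : ℂ) + 2) ≠ 0 := by
          norm_cast
        positivity
      exact mul_right_cancel₀ h2 h1
    have hgeom : ∀ j < l, n ≤ j → ∃ α β : ℂ,
        ∑ k ∈ Finset.range n, (C (exampleCoeff n j k * (a k - α)) +
          C (exampleCoeff n j k * (b k - β)) * X) * X ^ k = 0 := by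
      intro j hj hnj
      obtain ⟨α, β, h⟩ := hspace j hj
      refine ⟨α, β, ?_⟩
      rw [← sub_eq_zero, Finset.mul_sum, ← Finset.sum_sub_distrib] at h
      rw [← h]
      refine Finset.sum_congr rfl fun k hk => ?_
      rw [hab k (Finset.mem_range.1 hk)]
      simp only [C_mul, C_sub]
      ring
    have hconcl : ∀ α β : ℂ, (∀ k < n, a k = α ∧ b k = β) →
        ∃ α β : ℂ, ∀ k < n, s k = (C α + C β * X) * X ^ k := fun α β h =>
      ⟨α, β, fun k hk => by rw [hab k hk, (h k hk).1, (h k hk).2]⟩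
    have hone : ∀ k, exampleCoeff n n k = 1 := fun k => by simp [exampleCoeff]
    have htwo : ∀ k, exampleCoeff n (n + 1) k = 2 ^ k := fun k => by simp [exampleCoeff]
    obtain rfl | rfl | rfl : l = n ∨ l = n + 1 ∨ l = n + 2 := by omega
    · obtain ⟨σ, hσ⟩ := heig 0 (by omega)
      obtain ⟨σ', hσ'⟩ := heig 1 (by omega)
      refine hconcl (3 * σ - 2 * σ') (σ' - σ) fun k hk => ?_
      have h1 := hσ k hk
      have h2 := hσ' k hk
      push_cast at h1 h2
      exact ⟨by linear_combination 3 * h1 - 2 * h2, by linear_combination h2 - h1⟩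
    · obtain ⟨σ, hσ⟩ := heig 0 (by omega)
      obtain ⟨α, β, h⟩ := hgeom n (by omega) le_rfl
      have hev := congrArg (eval 2) h
      simp only [hone, one_mul] at h
      obtain ⟨h0, hrec, -⟩ := coeff_sum_linear_mul_X_pow _ _ h
      -- Evaluating at the eigenvector, one finds the eigenvalue.
      have hσ2 : σ = α + β * 2 := by
        rw [eval_finsetSum, eval_zero] at hev
        have h1 : ∑ k ∈ Finset.range n, (σ - (α + β * 2)) * (2 : ℂ) ^ k = 0 := by
          rw [← hev]
          refine Finset.sum_congr rfl fun k hk => ?_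
          have h2 := hσ k (Finset.mem_range.1 hk)
          push_cast at h2
          simp only [hone, eval_mul, eval_add, eval_C, eval_X, eval_pow, one_mul]
          rw [← h2]
          ring
        rw [← Finset.mul_sum] at h1
        refine sub_eq_zero.1 ((mul_eq_zero.1 h1).resolve_right ?_)
        have h3 : ∑ k ∈ Finset.range n, (2 : ℂ) ^ k = ((∑ k ∈ Finset.range n, 2 ^ k : ℕ) : ℂ) := by
          push_cast
          rfl
        rw [h3]
        exact Nat.cast_ne_zero.2 (Finset.sum_pos (fun k _ => by positivity)
          ⟨0, Finset.mem_range.2 (by omega)⟩).ne'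
      have hak : ∀ k < n, a k - α = 0 := by
        intro k
        induction k with
        | zero => exact h0
        | succ k ih =>
          intro hk
          have h1 := ih (by omega)
          have h2 := hσ k (by omega)
          have h3 := hrec k hk
          push_cast at h2
          linear_combination h3 + (h1 - h2 - hσ2) / 2
      refine hconcl α β fun k hk => ?_
      have h1 := hak k hk
      have h2 := hσ k hk
      push_cast at h2
      exact ⟨sub_eq_zero.1 h1, by linear_combination (h2 - h1 + hσ2) / 2⟩
    · obtain ⟨α, β, h⟩ := hgeom n (by omega) le_rfl
      obtain ⟨α', β', h'⟩ := hgeom (n + 1) (by omega) (by omega)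
      simp only [hone, one_mul] at h
      simp only [htwo] at h'
      obtain ⟨h0, hrec, hlast⟩ := coeff_sum_linear_mul_X_pow _ _ h
      obtain ⟨h0', hrec', hlast'⟩ := coeff_sum_linear_mul_X_pow _ _ h'
      have hα : α' = α := by
        have h1 := h0 (by omega)
        have h2 := h0' (by omega)
        linear_combination h1 - h2
      have hβ : β' = β := by
        have h1 := hlast (n - 1) (by omega)
        have h2 := (mul_eq_zero.1 (hlast' (n - 1) (by omega))).resolve_left
          (pow_ne_zero _ two_ne_zero)
        linear_combination h1 - h2
      subst hα hβ
      have hstep : ∀ k, k + 1 < n → a (k + 1) - α' = 0 ∧ b k - β' = 0 := by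
        intro k hk
        have h1 := hrec k hk
        have h2 : (2 : ℂ) ^ k * (2 * (a (k + 1) - α') + (b k - β')) = 0 := by
          rw [← hrec' k hk]
          ring
        have h3 := (mul_eq_zero.1 h2).resolve_left (pow_ne_zero _ two_ne_zero)
        exact ⟨by linear_combination h3 - h1, by linear_combination 2 * h1 - h3⟩
      refine hconcl α' β' fun k hk => ⟨sub_eq_zero.1 ?_, sub_eq_zero.1 ?_⟩
      · cases k with
        | zero => exact h0 (by omega)
        | succ k => exact (hstep k hk).1
      · by_cases hk' : k + 1 < n
        · exact (hstep k hk').2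
        · exact hlast k (by omega)

end Rigidity

end SecantRNC

/-! ### Data on the standard rational normal curve -/

namespace SecantRNC

section Example

open Matrix Polynomial

variable {n q l : ℕ}

/-- The standard parametrization by monomials. -/
noncomputable def monomialParam (n : ℕ) (i : Fin (n + 1)) : ℂ[X] := X ^ (i : ℕ)

/-- The polynomial of degree less than `n` with coefficients `y`. -/
noncomputable def toPoly (y : Fin n → ℂ) : ℂ[X] := ∑ k, C (y k) * X ^ (k : ℕ)

/-- The coefficients of `toPoly y`, as a form on `ℂⁿ⁺¹`. -/
def lowForm (n : ℕ) : (Fin n → ℂ) →ₗ[ℂ] (Fin (n + 1) → ℂ) where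
  toFun y := Fin.snoc (α := fun _ => ℂ) y 0
  map_add' y z := by
    funext m
    refine Fin.lastCases ?_ (fun k => ?_) m <;> simp
  map_smul' r y := by
    funext m
    refine Fin.lastCases ?_ (fun k => ?_) m <;> simp

/-- The coefficients of `X * toPoly y`, as a form on `ℂⁿ⁺¹`. -/
def highForm (n : ℕ) : (Fin n → ℂ) →ₗ[ℂ] (Fin (n + 1) → ℂ) where
  toFun y := Fin.cons (α := fun _ => ℂ) 0 y
  map_add' y z := by
    funext m
    refine Fin.cases ?_ (fun k => ?_) m <;> simp
  map_smul' r y := by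
    funext m
    refine Fin.cases ?_ (fun k => ?_) m <;> simp

lemma pull_lowForm (y : Fin n → ℂ) : pull (monomialParam n) (lowForm n y) = toPoly y := by
  rw [pull_apply, Fin.sum_univ_castSucc]
  simp [lowForm, monomialParam, toPoly, smul_eq_C_mul]

lemma pull_highForm (y : Fin n → ℂ) : pull (monomialParam n) (highForm n y) = X * toPoly y := by
  rw [pull_apply, Fin.sum_univ_succ, toPoly, Finset.mul_sum]
  simp only [highForm, LinearMap.coe_mk, AddHom.coe_mk, Fin.cons_zero, zero_smul, zero_add,
    Fin.cons_succ, monomialParam, smul_eq_C_mul, Fin.val_succ]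
  exact Finset.sum_congr rfl fun k _ => by ring

lemma isParam_monomialParam (n : ℕ) : IsParam (monomialParam n) := by
  refine ⟨fun i => ?_, Fintype.linearIndependent_iff.2 fun g hg k => ?_⟩
  · rw [monomialParam, natDegree_X_pow]
    exact Nat.lt_succ_iff.1 i.2
  · have := congrArg (fun g => coeff g (k : ℕ)) hg
    simpa [monomialParam, coeff_X_pow, Fin.val_inj] using this

/-- The data on the standard rational normal curve whose points have the parameters `1, 2, …` and
whose linear spaces are spanned by the zeros of the polynomials with coefficients `y`. -/
def exampleCoords (n q l : ℕ) (y : Fin l × Fin n → ℂ) : CoordIndex n (q + 1) l → ℂ :=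
  Sum.elim (fun im => (((im.1 : ℕ) : ℂ) + 1) ^ (im.2 : ℕ))
    (fun jkm => (![lowForm n fun k => y (jkm.1, k), highForm n fun k => y (jkm.1, k)] jkm.2.1)
      jkm.2.2)

lemma pt_exampleCoords (y : Fin l × Fin n → ℂ) (i : Fin (q + 1)) :
    pt (exampleCoords n q l y) i = evalAt (monomialParam n) (((i : ℕ) : ℂ) + 1) := by
  funext m
  simp [exampleCoords, evalAt, monomialParam]

lemma pt_exampleCoords_zero (y : Fin l × Fin n → ℂ) (m : Fin (n + 1)) :
    pt (exampleCoords n q l y) 0 m = 1 := by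
  simp [exampleCoords]

lemma pt_exampleCoords_succ (y : Fin l × Fin n → ℂ) (i : Fin q) :
    pt (exampleCoords n q l y) i.succ = evalAt (monomialParam n) (((i : ℕ) : ℂ) + 2) := by
  rw [pt_exampleCoords, Fin.val_succ]
  congr 1
  push_cast
  ring

lemma eqn_exampleCoords_zero (y : Fin l × Fin n → ℂ) (j : Fin l) :
    eqn (exampleCoords n q l y) j 0 = lowForm n fun k => y (j, k) := rfl

lemma eqn_exampleCoords_one (y : Fin l × Fin n → ℂ) (j : Fin l) :
    eqn (exampleCoords n q l y) j 1 = highForm n fun k => y (j, k) := rfl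

lemma dotProduct_pt_exampleCoords_zero (y : Fin l × Fin n → ℂ) (v : Fin (n + 1) → ℂ) :
    v ⬝ᵥ pt (exampleCoords n q l y) 0 = (pull (monomialParam n) v).eval 1 := by
  rw [eval_pull, pt_exampleCoords]
  simp

lemma memberAt_exampleCoords (y : Fin l × Fin n → ℂ) (j : Fin l) :
    memberAt (pt (exampleCoords n q l y) 0) (eqn (exampleCoords n q l y) j) =
      (toPoly fun k => y (j, k)).eval 1 •
        (lowForm n (fun k => y (j, k)) - highForm n fun k => y (j, k)) := by
  rw [memberAt, dotProduct_pt_exampleCoords_zero, dotProduct_pt_exampleCoords_zero,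
    eqn_exampleCoords_zero, eqn_exampleCoords_one, pull_lowForm, pull_highForm, eval_mul, eval_X,
    one_mul]
  module

/-- The coefficients of `X ^ k + ⋯ + X ^ (n - 1)`. -/
def tail (k : Fin n) (j : Fin n) : ℂ := if k ≤ j then 1 else 0

lemma one_sub_X_mul_toPoly_tail (k : Fin n) :
    (1 - X) * toPoly (tail k) = X ^ (k : ℕ) - X ^ n := by
  have h1 : toPoly (tail k) = ∑ i ∈ Finset.Ico (k : ℕ) n, X ^ i := by
    have h2 : Finset.Ico (k : ℕ) n = {i ∈ Finset.range n | (k : ℕ) ≤ i} := by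
      ext i
      simp [and_comm]
    rw [h2, Finset.sum_filter, Finset.sum_range, toPoly]
    exact Finset.sum_congr rfl fun j _ => by simp [tail, apply_ite C]
  rw [h1, ← neg_sub, neg_mul, mul_comm, geom_sum_Ico_mul _ k.2.le]
  ring

lemma formsAt_exampleCoords (y : Fin l × Fin n → ℂ) (k : Fin n) :
    formsAt (pt (exampleCoords n q l y) 0) k = lowForm n (tail k) - highForm n (tail k) := by
  apply (isParam_monomialParam n).pull_injective
  rw [map_sub, pull_lowForm, pull_highForm, ← one_sub_mul, one_sub_X_mul_toPoly_tail, formsAt,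
    pt_exampleCoords_zero, pt_exampleCoords_zero, map_sub, map_smul, map_smul, one_smul, one_smul]
  simp [pull, Fintype.linearCombination_apply_single, monomialParam]

lemma pull_formsAt_exampleCoords (y : Fin l × Fin n → ℂ) (k : Fin n) :
    pull (monomialParam n) (formsAt (pt (exampleCoords n q l y) 0) k) =
      (1 - X) * toPoly (tail k) := by
  rw [formsAt_exampleCoords, map_sub, pull_lowForm, pull_highForm]
  ring

lemma formsAt_exampleCoords_ne_zero [NeZero n] (y : Fin l × Fin n → ℂ) (i : Fin q) :
    formsAt (pt (exampleCoords n q l y) 0) 0 ⬝ᵥ pt (exampleCoords n q l y) i.succ ≠ 0 := by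
  rw [pt_exampleCoords_succ, ← eval_pull, pull_formsAt_exampleCoords, one_sub_X_mul_toPoly_tail]
  simp only [eval_sub, eval_pow, eval_X, eval_one, Fin.val_zero, pow_zero, ne_eq, sub_eq_zero]
  norm_cast
  exact (Nat.one_lt_pow (NeZero.ne n) (show 1 < (i : ℕ) + 2 by omega)).ne

lemma sum_exampleCoeff_ne_zero (hn : 1 ≤ n) (j : ℕ) :
    ∑ k : Fin n, exampleCoeff n j k ≠ 0 := by
  have h : ∀ k, exampleCoeff n j k =
      ((if j < n then (if k = j then 1 else 0) else if j = n then 1 else 2 ^ k : ℕ) : ℂ) := by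
    intro k
    simp [exampleCoeff]
  simp only [h]
  rw [← Nat.cast_sum]
  refine Nat.cast_ne_zero.2 (ne_of_gt ?_)
  by_cases hj : j < n
  · exact Finset.sum_pos' (fun _ _ => Nat.zero_le _) ⟨⟨j, hj⟩, Finset.mem_univ _, by simp [hj]⟩
  · refine Finset.sum_pos (fun k _ => ?_) ⟨⟨0, hn⟩, Finset.mem_univ _⟩
    simp only [hj, if_false]
    split_ifs <;> positivity

/-- For the special data given by `exampleCoeff`, the linear system has only one solution up to
scalars. -/
lemma eq_zero_of_system_exampleCoords [NeZero n] (hn : 2 ≤ n) (hql : q + l = n + 2)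
    (hl : l ≤ 1 ∨ n ≤ l) (x : Unknown n q l → ℂ)
    (hx : system (exampleCoords n q l fun jk => exampleCoeff n jk.1 jk.2) x = 0)
    (hx1 : x (Sum.inl (0, Fin.succ 0)) = 0) : x = 0 := by
  obtain ⟨hop, hx0⟩ := (system_eq_zero_iff _ _).1 hx
  set y : Fin l × Fin n → ℂ := fun jk => exampleCoeff n jk.1 jk.2 with hy
  set c := exampleCoords n q l y with hc
  have hmono := isParam_monomialParam n
  have hlast : pt c 0 (Fin.last n) = 1 := pt_exampleCoords_zero y _
  -- The operator, as a map from the polynomials `g` of degree less than `n`, which stand for the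
  -- forms `(1 - X) * g` that vanish at the first point, to polynomials of degree at most `n`.
  let L : (Fin n → ℂ) →ₗ[ℂ] ℂ[X] :=
    Fintype.linearCombination ℂ (fun k => pull (monomialParam n) (opForms x k)) ∘ₗ
      LinearMap.funLeft ℂ ℂ Fin.castSucc ∘ₗ (lowForm n - highForm n)
  have hL : ∀ g, L g = ∑ k : Fin n, (lowForm n g - highForm n g) k.castSucc •
      pull (monomialParam n) (opForms x k) := fun g => rfl
  have hsum : ∀ g, L g = ∑ k, C (g k) * L (Pi.single k 1) := by
    intro g
    conv_lhs => rw [pi_eq_sum_univ' g]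
    simp [smul_eq_C_mul]
  have hforms : ∀ g, ∑ k : Fin n, (lowForm n g - highForm n g) k.castSucc • formsAt (pt c 0) k =
      lowForm n g - highForm n g := by
    intro g
    rw [sum_smul_formsAt, hlast, one_smul]
    rw [dotProduct_pt_exampleCoords_zero, map_sub, pull_lowForm, pull_highForm]
    simp
  have htail : ∀ k, pull (monomialParam n) (opForms x k) = L (tail k) := by
    intro k
    rw [hL, ← formsAt_exampleCoords (q := q) y k, Finset.sum_eq_single k]
    · simp [formsAt, pt_exampleCoords_zero, (Fin.castSucc_lt_last k).ne]
    · intro k' _ hk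
      have : k'.castSucc ≠ k.castSucc := fun h => hk (Fin.castSucc_injective _ h)
      simp [formsAt, (Fin.castSucc_lt_last k').ne, this]
    · simp
  have hdegL : ∀ g, (L g).natDegree ≤ n := fun g => by
    rw [hL]
    exact natDegree_sum_le_of_forall_le _ _ fun k _ =>
      (natDegree_smul_le _ _).trans (hmono.natDegree_pull_le _)
  have hmember : ∀ j, (toPoly fun k => y (j, k)).eval 1 • L (fun k => y (j, k)) =
      pull (monomialParam n) (opMember c x j) := by
    intro j
    rw [← hop.space, map_sum, hL, Finset.smul_sum]
    refine Finset.sum_congr rfl fun k _ => ?_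
    rw [memberAt_exampleCoords, map_smul, Pi.smul_apply, smul_assoc]
  have hopm : ∀ j, pull (monomialParam n) (opMember c x j) =
      (C (x (Sum.inr (Sum.inl (j, 0)))) + C (x (Sum.inr (Sum.inl (j, 1)))) * X) *
        toPoly fun k => y (j, k) := by
    intro j
    rw [opMember, eqn_exampleCoords_zero, eqn_exampleCoords_one, map_add, map_smul, map_smul,
      pull_lowForm, pull_highForm, smul_eq_C_mul, smul_eq_C_mul]
    ring
  have hY1 : ∀ j : Fin l, (toPoly fun k => y (j, k)).eval 1 ≠ 0 := by
    intro j
    have := sum_exampleCoeff_ne_zero (n := n) (by omega) (j : ℕ)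
    simpa [toPoly, eval_finsetSum, hy] using this
  have hpointL : ∀ (i : Fin q) g, (L g).eval (((i : ℕ) : ℂ) + 2) =
      param x i * (1 - (((i : ℕ) : ℂ) + 2)) * (toPoly g).eval (((i : ℕ) : ℂ) + 2) := by
    intro i g
    have h1 : (L g).eval (((i : ℕ) : ℂ) + 2) =
        param x i * ((lowForm n g - highForm n g) ⬝ᵥ pt c i.succ) := by
      rw [← hforms, hL, eval_finsetSum, sum_dotProduct, Finset.mul_sum]
      refine Finset.sum_congr rfl fun k _ => ?_
      rw [eval_smul, eval_pull, ← pt_exampleCoords_succ y, hop.point, smul_dotProduct, smul_eq_mul,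
        smul_eq_mul]
      ring
    rw [h1, pt_exampleCoords_succ, ← eval_pull, map_sub, pull_lowForm, pull_highForm, eval_sub,
      eval_mul, eval_X]
    ring
  -- The operator is multiplication by an affine function.
  obtain ⟨α, β, hαβ⟩ := exists_eq_affine_mul hn hql hl
    (fun k => if h : k < n then L (Pi.single ⟨k, h⟩ 1) else 0)
    (fun k hk => by simpa [hk] using hdegL _)
    (fun j hj => by
      refine ⟨((toPoly fun k => y (⟨j, hj⟩, k)).eval 1)⁻¹ * x (Sum.inr (Sum.inl (⟨j, hj⟩, 0))),
        ((toPoly fun k => y (⟨j, hj⟩, k)).eval 1)⁻¹ * x (Sum.inr (Sum.inl (⟨j, hj⟩, 1))), ?_⟩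
      have h1 := hmember ⟨j, hj⟩
      rw [hopm, ← eq_inv_smul_iff₀ (hY1 _), hsum] at h1
      simp only [Finset.sum_range, Fin.is_lt, dite_true, Fin.eta]
      rw [show ∑ k : Fin n, C (exampleCoeff n j k) * L (Pi.single k 1) = _ from h1, smul_eq_C_mul,
        toPoly, C_mul, C_mul]
      ring)
    (fun i hi => by
      refine ⟨param x ⟨i, hi⟩ * (1 - ((i : ℂ) + 2)), fun k hk => ?_⟩
      have h1 := hpointL ⟨i, hi⟩ (Pi.single ⟨k, hk⟩ 1)
      have h2 : toPoly (Pi.single (⟨k, hk⟩ : Fin n) (1 : ℂ)) = X ^ k := by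
        rw [toPoly, Finset.sum_eq_single ⟨k, hk⟩]
        · simp
        · intro b _ hb
          simp [hb]
        · simp
      rw [h2] at h1
      simpa [hk] using h1)
  have hLg : ∀ g, L g = (C α + C β * X) * toPoly g := by
    intro g
    rw [hsum, toPoly, Finset.mul_sum]
    refine Finset.sum_congr rfl fun k _ => ?_
    have := hαβ k k.2
    simp only [Fin.is_lt, dite_true, Fin.eta] at this
    rw [this]
    ring
  have hT : ∀ k, opForms x k = α • lowForm n (tail k) + β • highForm n (tail k) := by
    intro k
    apply hmono.pull_injective
    rw [htail, hLg, map_add, map_smul, map_smul, pull_lowForm, pull_highForm, smul_eq_C_mul,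
      smul_eq_C_mul]
    ring
  have hα : α = 0 := by
    have h1 := hT 0
    have h2 := congrFun h1 0
    rw [hx0] at h2
    have h3 : lowForm n (tail 0) 0 = 1 := by
      have : (0 : Fin (n + 1)) = (0 : Fin n).castSucc := rfl
      rw [this]
      exact (Fin.snoc_castSucc (α := fun _ => ℂ) _ _ _).trans (by simp [tail])
    have h4 : highForm n (tail 0) 0 = 0 := rfl
    simpa [h3, h4] using h2.symm
  have hβ : β = 0 := by
    have h1 := congrFun (hT 0) (Fin.succ 0)
    have h2 : opForms x 0 (Fin.succ 0) = 0 := hx1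
    have h4 : highForm n (tail 0) (Fin.succ 0) = 1 := by
      change tail (0 : Fin n) (0 : Fin n) = 1
      simp [tail]
    rw [h2, hα, zero_smul, zero_add, Pi.smul_apply, h4] at h1
    simpa using h1.symm
  have hT0 : ∀ k, opForms x k = 0 := fun k => by rw [hT, hα, hβ, zero_smul, zero_smul, add_zero]
  funext v
  rcases v with ⟨k, m⟩ | ⟨j, k⟩ | i
  · exact congrFun (hT0 k) m
  · have h1 := hopm j
    rw [← hop.space] at h1
    simp only [hT0, smul_zero, Finset.sum_const_zero, map_zero] at h1
    have h2 : (toPoly fun k => y (j, k)) ≠ 0 := fun h => hY1 j (by rw [h, eval_zero])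
    have h3 := (mul_eq_zero.1 h1.symm).resolve_right h2
    have h5 := congrArg (fun g => coeff g 0) h3
    have h6 := congrArg (fun g => coeff g 1) h3
    simp [coeff_C] at h5 h6
    fin_cases k
    · exact h5
    · exact h6
  · have h1 := hop.point i 0
    rw [hT0, zero_dotProduct] at h1
    exact (mul_eq_zero.1 h1.symm).resolve_right (formsAt_exampleCoords_ne_zero y i)

end Example

end SecantRNC

/-! ### Generic existence and uniqueness -/

namespace SecantRNC

section Existence

open Matrix Polynomial

variable {n q l : ℕ}

/-- The operator of the standard rational normal curve. With respect to the parameter of the curve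
that is infinite at the first point, it sends `(1 - X) * g` to `X * g`. -/
noncomputable def standardOp (y : Fin l × Fin n → ℂ) : Unknown n q l → ℂ :=
  Sum.elim (fun km => highForm n (tail km.1) km.2)
    (Sum.elim (fun jk => ![0, (toPoly fun k => y (jk.1, k)).eval 1] jk.2)
      fun i => (((i : ℕ) : ℂ) + 2) / (1 - (((i : ℕ) : ℂ) + 2)))

lemma opForms_standardOp (y : Fin l × Fin n → ℂ) (k : Fin n) :
    opForms (standardOp (q := q) y) k = highForm n (tail k) := rfl

lemma one_sub_X_mul_pull_opForms (y : Fin l × Fin n → ℂ) (k : Fin n) :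
    (1 - X) * pull (monomialParam n) (opForms (standardOp (q := q) y) k) =
      X * pull (monomialParam n) (formsAt (pt (exampleCoords n q l y) 0) k) := by
  rw [opForms_standardOp, pull_highForm, pull_formsAt_exampleCoords]
  ring

lemma one_sub_X_ne_zero : (1 - X : ℂ[X]) ≠ 0 := by
  intro h
  have := congrArg (eval 0) h
  simp at this

lemma isOperator_standardOp (y : Fin l × Fin n → ℂ) :
    IsOperator (exampleCoords n q l y) (standardOp y) where
  space j := by
    apply (isParam_monomialParam n).pull_injective
    apply mul_left_cancel₀ one_sub_X_ne_zero
    have h := congrArg (pull (monomialParam n)) (sum_smul_formsAt (memberAt_dotProduct_self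
      (pt (exampleCoords n q l y) 0) (eqn (exampleCoords n q l y) j)))
    rw [pt_exampleCoords_zero, one_smul, memberAt_exampleCoords, map_smul, map_sub, pull_lowForm,
      pull_highForm, map_sum] at h
    rw [map_sum, Finset.mul_sum]
    simp only [map_smul, mul_smul_comm, one_sub_X_mul_pull_opForms]
    simp only [map_smul, ← memberAt_exampleCoords (q := q)] at h
    simp only [← mul_smul_comm, ← Finset.mul_sum, h]
    rw [opMember, map_add, map_smul, map_smul, eqn_exampleCoords_zero, eqn_exampleCoords_one,
      pull_lowForm, pull_highForm]
    simp only [standardOp, Sum.elim_inr, Sum.elim_inl, Matrix.cons_val_zero, Matrix.cons_val_one,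
      smul_eq_C_mul, C_0]
    ring
  point i k := by
    have h := congrArg (eval (((i : ℕ) : ℂ) + 2)) (one_sub_X_mul_pull_opForms (q := q) y k)
    simp only [eval_mul, eval_sub, eval_one, eval_X] at h
    have h1 : 1 - (((i : ℕ) : ℂ) + 2) ≠ 0 := by
      intro h1
      have : ((i : ℕ) : ℂ) + 1 = 0 := by linear_combination -h1
      exact Nat.cast_add_one_ne_zero (i : ℕ) this
    rw [pt_exampleCoords_succ, ← eval_pull, ← eval_pull, show param (standardOp y) i =
      (((i : ℕ) : ℂ) + 2) / (1 - (((i : ℕ) : ℂ) + 2)) from rfl, div_mul_eq_mul_div, eq_div_iff h1,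
      mul_comm, h]

lemma system_standardOp [NeZero n] (y : Fin l × Fin n → ℂ) :
    system (exampleCoords n q l y) (standardOp y) = 0 :=
  (system_eq_zero_iff _ _).2 ⟨isOperator_standardOp y, rfl⟩

lemma standardOp_ne_zero [NeZero n] (y : Fin l × Fin n → ℂ) : standardOp (q := q) y ≠ 0 := by
  intro h
  have h1 := congrFun h (Sum.inl (0, Fin.succ 0))
  change tail (0 : Fin n) (0 : Fin n) = 0 at h1
  simp [tail] at h1

/-- On the standard curve, the minors of a multiple of its operator are a reparametrization of the
curve, where `x` corresponds to the parameter `β * x / (1 - x)`. -/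
lemma isGood_exampleCoords (hn : 1 ≤ n) {y : Fin l × Fin n → ℂ}
    (htest : ∀ j, rootsTest (n - 1) (toPoly fun k => y (j, k)) ≠ 0)
    (hone : ∀ j, (toPoly fun k => y (j, k)).eval 1 ≠ 0) {x : Unknown n q l → ℂ}
    (hx : IsOperator (exampleCoords n q l y) x) {β : ℂ} (hβ : β ≠ 0)
    (hT : ∀ k, opForms x k = β • opForms (standardOp (q := q) y) k) :
    IsGood (exampleCoords n q l y) x := by
  set c := exampleCoords n q l y with hc
  have hmono := isParam_monomialParam n
  have hP : pt c 0 (Fin.last n) ≠ 0 := by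
    rw [pt_exampleCoords_zero]
    exact one_ne_zero
  have hε := linearIndependent_formsAt hP
  set ε := formsAt (pt c 0) with hεdef
  set T := opForms x with hTdef
  set φ := minorParam ε T with hφdef
  have hrow : ∀ (Z : ℂ) k, (1 - X) * pull (monomialParam n) (Z • ε k - T k) =
      (C Z * (1 - X) - C β * X) * pull (monomialParam n) (ε k) := by
    intro Z k
    rw [map_sub, map_smul, hT, map_smul, smul_eq_C_mul, smul_eq_C_mul, mul_sub, mul_left_comm,
      mul_left_comm (1 - X) (C β), one_sub_X_mul_pull_opForms (q := q)]
    ring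
  -- The point with parameter `x` is in the kernel of the pencil at `β * x / (1 - x)`.
  have hker : ∀ x ≠ (1 : ℂ), ∀ k,
      ((β * x / (1 - x)) • ε k - T k) ⬝ᵥ evalAt (monomialParam n) x = 0 := by
    intro x hx1 k
    have h1 : 1 - x ≠ 0 := sub_ne_zero.2 hx1.symm
    have h2 := congrArg (eval x) (hrow (β * x / (1 - x)) k)
    simp only [eval_mul, eval_sub, eval_one, eval_X, eval_C, div_mul_cancel₀ _ h1, sub_self,
      zero_mul] at h2
    rw [← eval_pull]
    exact (mul_eq_zero.1 h2).resolve_left h1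
  have hli : ∀ Z : ℂ, LinearIndependent ℂ fun k => Z • ε k - T k := by
    intro Z
    rw [Fintype.linearIndependent_iff] at hε ⊢
    intro g hg
    apply hε
    rw [← hmono.pull_eq_zero_iff]
    have h1 : (C Z * (1 - X) - C β * X : ℂ[X]) ≠ 0 := by
      intro h1
      have h2 := congrArg (eval 0) h1
      have h3 := congrArg (eval 1) h1
      simp at h2 h3
      exact hβ h3
    have h2 : (C Z * (1 - X) - C β * X) * pull (monomialParam n) (∑ k, g k • ε k) =
        (1 - X) * pull (monomialParam n) (∑ k, g k • (Z • ε k - T k)) := by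
      simp only [map_sum, map_smul, Finset.mul_sum, mul_smul_comm, hrow]
    rw [hg, map_zero, mul_zero] at h2
    exact (mul_eq_zero.1 h2).resolve_left h1
  have hφ : IsParam φ := by
    refine ⟨natDegree_minorParam_le ε T, Fintype.linearIndependent_iff.2 fun g hg => ?_⟩
    have hpull : pull φ g = 0 := hg
    have hroot : ∀ x ≠ (1 : ℂ), (pull (monomialParam n) g).eval x = 0 := by
      intro x hx1
      have h1 := dotProduct_evalAt_minorParam ε T g (β * x / (1 - x))
      rw [← eval_pull, ← hφdef, hpull, eval_zero] at h1
      have h2 : ¬ LinearIndependent ℂ (Fin.cons (α := fun _ => Fin (n + 1) → ℂ) g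
          fun k => (β * x / (1 - x)) • ε k - T k) := by
        intro h2
        have h3 := (Matrix.isUnit_iff_isUnit_det _).1
          (Matrix.linearIndependent_rows_iff_isUnit.1 h2)
        exact h3.ne_zero h1.symm
      rw [linearIndependent_finCons, not_and, not_not] at h2
      obtain ⟨a, ha⟩ := (Submodule.mem_span_range_iff_exists_fun ℂ).1 (h2 (hli _))
      rw [eval_pull, ← ha, sum_dotProduct]
      refine Finset.sum_eq_zero fun k _ => ?_
      rw [smul_dotProduct, hker x hx1, smul_zero]
    have hz : pull (monomialParam n) g = 0 := by
      refine eq_zero_of_infinite_isRoot _ (Set.Infinite.mono (fun x hx1 => hroot x hx1) ?_)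
      exact (Set.finite_singleton (1 : ℂ)).infinite_compl
    rw [hmono.pull_eq_zero_iff] at hz
    simp [hz]
  refine ⟨(paramTest_ne_zero_iff _ _).2 hφ, fun j => ?_⟩
  set μ := memberAt (pt c 0) (eqn c j) with hμdef
  have hY : (toPoly fun k => y (j, k)) ≠ 0 := fun h => hone j (by rw [h, eval_zero])
  have hμ : pull (monomialParam n) μ = C ((toPoly fun k => y (j, k)).eval 1) *
      ((1 - X) * toPoly fun k => y (j, k)) := by
    rw [hμdef, memberAt_exampleCoords, map_smul, map_sub, pull_lowForm, pull_highForm,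
      smul_eq_C_mul]
    ring
  have hμ0 : pull φ μ ≠ 0 := by
    rw [ne_eq, hφ.pull_eq_zero_iff, ← hmono.pull_eq_zero_iff, hμ]
    exact mul_ne_zero (C_ne_zero.2 (hone j)) (mul_ne_zero one_sub_X_ne_zero hY)
  have hdeg : (pull φ μ).natDegree ≤ n - 1 := by
    have h1 := hφ.natDegree_pull_le (opMember c x j)
    rw [hx.pull_opMember (pull_minorParam ε T) j, natDegree_C_mul hP, natDegree_X_mul hμ0] at h1
    omega
  have hYdeg : (toPoly fun k => y (j, k)).natDegree ≤ n - 1 :=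
    natDegree_sum_le_of_forall_le _ _ fun k _ =>
      (natDegree_C_mul_X_pow_le _ _).trans (by omega)
  have hcard := ncard_roots_of_rootsTest_ne_zero hYdeg (htest j)
  set s : Finset ℂ := (toPoly fun k => y (j, k)).roots.toFinset with hs
  have hs' : {x | (toPoly fun k => y (j, k)).eval x = 0} = (s : Set ℂ) := by
    ext x
    simp [hs, hY]
  rw [hs', Set.ncard_coe_finset] at hcard
  have hs1 : ∀ x ∈ s, x ≠ 1 ∧ (toPoly fun k => y (j, k)).eval x = 0 := by
    intro x hxs
    have h1 : (toPoly fun k => y (j, k)).eval x = 0 := by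
      have : x ∈ (s : Set ℂ) := hxs
      rwa [← hs'] at this
    exact ⟨fun h => hone j (h ▸ h1), h1⟩
  refine rootsTest_ne_zero hdeg hμ0 (s.image fun x => β * x / (1 - x)) ?_ ?_
  · rw [Finset.card_image_of_injOn, hcard]
    intro a ha b hb hab
    have h1 : 1 - a ≠ 0 := sub_ne_zero.2 (hs1 a ha).1.symm
    have h2 : 1 - b ≠ 0 := sub_ne_zero.2 (hs1 b hb).1.symm
    simp only at hab
    rw [div_eq_div_iff h1 h2] at hab
    have h3 : β * (a - b) = 0 := by linear_combination hab
    exact sub_eq_zero.1 ((mul_eq_zero.1 h3).resolve_left hβ)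
  · intro Z hZ
    obtain ⟨x, hxs, rfl⟩ := Finset.mem_image.1 hZ
    obtain ⟨hx1, hx0⟩ := hs1 x hxs
    rw [eval_pull, dotProduct_evalAt_minorParam, ← Matrix.exists_mulVec_eq_zero_iff]
    refine ⟨evalAt (monomialParam n) x, hmono.evalAt_ne_zero x, ?_⟩
    funext i
    refine Fin.cases ?_ (fun k => ?_) i
    · change μ ⬝ᵥ evalAt (monomialParam n) x = 0
      rw [← eval_pull, hμ]
      simp [hx0]
    · exact hker x hx1 k

lemma exists_hasCoords_exampleCoords {y : Fin l × Fin n → ℂ}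
    (hy : ∀ j, (toPoly fun k => y (j, k)) ≠ 0) :
    ∃ δ : Datum n (q + 1) l, δ.HasCoords (exampleCoords n q l y) := by
  refine exists_hasCoords_of_linearIndependent _ (fun i => ?_) fun j => ?_
  · rw [pt_exampleCoords]
    exact (isParam_monomialParam n).evalAt_ne_zero _
  · have : eqn (exampleCoords n q l y) j =
        ![lowForm n fun k => y (j, k), highForm n fun k => y (j, k)] := by
      funext k
      fin_cases k <;> rfl
    rw [this, LinearIndependent.pair_iff]
    intro a b hab
    have h1 := congrArg (pull (monomialParam n)) hab
    rw [map_add, map_smul, map_smul, pull_lowForm, pull_highForm, map_zero, smul_eq_C_mul,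
      smul_eq_C_mul] at h1
    have h2 : (C a + C b * X) * (toPoly fun k => y (j, k)) = 0 := by
      rw [← h1]
      ring
    have h3 := (mul_eq_zero.1 h2).resolve_right (hy j)
    have h4 := congrArg (eval 0) h3
    have h5 := congrArg (eval 1) h3
    simp only [eval_add, eval_mul, eval_C, eval_X, eval_zero, mul_zero, add_zero, mul_one] at h4 h5
    exact ⟨h4, by rw [h4, zero_add] at h5; exact h5⟩

lemma isPolyFun_exampleCoords (s : CoordIndex n (q + 1) l) :
    IsPolyFun (fun y : Fin l × Fin n → ℂ => exampleCoords n q l y s) := by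
  rcases s with ⟨i, m⟩ | ⟨j, k, m⟩
  · exact IsPolyFun.const _
  · fin_cases k
    · change IsPolyFun fun y : Fin l × Fin n → ℂ => lowForm n (fun k => y (j, k)) m
      refine Fin.lastCases ?_ (fun k => ?_) m
      · simpa [lowForm] using IsPolyFun.const 0
      · simpa [lowForm] using IsPolyFun.coord (j, k)
    · change IsPolyFun fun y : Fin l × Fin n → ℂ => highForm n (fun k => y (j, k)) m
      refine Fin.cases ?_ (fun k => ?_) m
      · exact IsPolyFun.const 0
      · exact IsPolyFun.coord (j, k)

lemma isPolyFamily_toPoly (j : Fin l) :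
    IsPolyFamily (fun y : Fin l × Fin n → ℂ => toPoly fun k => y (j, k)) :=
  IsPolyFamily.sum fun _ _ => (IsPolyFamily.C (IsPolyFun.coord _)).mul (IsPolyFamily.const _)

/-- For a generic choice of the polynomials that define the linear spaces of the example, their
roots are distinct, and any given nonempty open condition is satisfied. -/
lemma exists_good_exampleCoords (hn : 1 ≤ n) {D : (CoordIndex n (q + 1) l → ℂ) → ℂ}
    (hD : IsPolyFun D) {y₀ : Fin l × Fin n → ℂ} (hD₀ : D (exampleCoords n q l y₀) ≠ 0) :
    ∃ y : Fin l × Fin n → ℂ, D (exampleCoords n q l y) ≠ 0 ∧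
      (∀ j, rootsTest (n - 1) (toPoly fun k => y (j, k)) ≠ 0) ∧
      ∀ j, (toPoly fun k => y (j, k)).eval 1 ≠ 0 := by
  have hone : ∀ j, IsPolyFun fun y : Fin l × Fin n → ℂ => (toPoly fun k => y (j, k)).eval 1 := by
    intro j
    simp only [toPoly, eval_finsetSum, eval_mul, eval_C, eval_pow, eval_X, one_pow, mul_one]
    exact IsPolyFun.sum fun _ _ => IsPolyFun.coord _
  let g : ℂ[X] := ∏ i ∈ Finset.range (n - 1), (X - C ((i : ℂ) + 2))
  have hg : g.natDegree = n - 1 :=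
    (natDegree_finsetProd_X_sub_C_eq_card _ _).trans (Finset.card_range _)
  have hg0 : g ≠ 0 := (monic_prod_of_monic _ _ fun i _ => monic_X_sub_C _).ne_zero
  have hgtest : rootsTest (n - 1) g ≠ 0 := by
    refine rootsTest_ne_zero hg.le hg0 ((Finset.range (n - 1)).image fun i : ℕ => (i : ℂ) + 2) ?_ ?_
    · rw [Finset.card_image_of_injective, Finset.card_range]
      intro a b hab
      simpa using hab
    · intro x hx
      obtain ⟨i, hi, rfl⟩ := Finset.mem_image.1 hx
      rw [eval_prod]
      exact Finset.prod_eq_zero hi (by simp)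
  have hg1 : g.eval 1 ≠ 0 := by
    rw [eval_prod, Finset.prod_ne_zero_iff]
    intro i _ h
    simp only [eval_sub, eval_X, eval_C] at h
    have : (i : ℂ) + 1 = 0 := by linear_combination -h
    exact Nat.cast_add_one_ne_zero i this
  have hgy : ∀ j : Fin l,
      (toPoly fun k : Fin n => (fun jk : Fin l × Fin n => g.coeff jk.2) (j, k)) = g := by
    intro j
    conv_rhs => rw [as_sum_range_C_mul_X_pow' g (show g.natDegree < n by omega), Finset.sum_range]
    rfl
  obtain ⟨y, hy⟩ := IsPolyFun.exists_forall_ne_zero (s := Finset.univ)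
    (f := fun o : Option (Fin l) => fun y : Fin l × Fin n → ℂ => o.elim (D (exampleCoords n q l y))
      fun j => rootsTest (n - 1) (toPoly fun k => y (j, k)) * (toPoly fun k => y (j, k)).eval 1)
    (by
      rintro (_ | j) -
      · exact hD.comp isPolyFun_exampleCoords
      · exact ((isPolyFamily_toPoly j).rootsTest _).mul (hone j))
    (by
      rintro (_ | j) -
      · exact ⟨y₀, hD₀⟩
      · refine ⟨fun jk => g.coeff jk.2, ?_⟩
        simp only [Option.elim_some]
        rw [hgy j]
        exact mul_ne_zero hgtest hg1)
  exact ⟨y, hy none (Finset.mem_univ _),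
    fun j => left_ne_zero_of_mul (hy (some j) (Finset.mem_univ _)),
    fun j => right_ne_zero_of_mul (hy (some j) (Finset.mem_univ _))⟩

theorem generically_existsUnique (hn : 2 ≤ n) (hql : q + l = n + 2) (hl : l ≤ 1 ∨ n ≤ l) :
    Generically (fun δ : Datum n (q + 1) l => ∃! S : Set (PSpace n), δ.IsSolution S) := by
  have : NeZero n := ⟨by omega⟩
  refine generically_existsUnique_of_example hn hql
    (exampleCoords n q l fun jk => exampleCoeff n jk.1 jk.2) (Sum.inl (0, Fin.succ 0))
    (eq_zero_of_system_exampleCoords hn hql hl) fun D hD hD₀ => ?_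
  obtain ⟨y, hDy, htest, hone⟩ := exists_good_exampleCoords (by omega) hD hD₀
  obtain ⟨δ, hδ⟩ := exists_hasCoords_exampleCoords (q := q) (y := y)
    fun j h => hone j (by rw [h, eval_zero])
  refine ⟨δ, _, hδ, hDy, by rw [pt_exampleCoords_zero]; exact one_ne_zero,
    formsAt_exampleCoords_ne_zero y, fun x hx hker => ?_⟩
  obtain ⟨s, hs⟩ := hker _ (system_standardOp y)
  have hs0 : s ≠ 0 := by
    rintro rfl
    exact standardOp_ne_zero (q := q) y (by rw [hs, zero_smul])
  have hxs : x = s⁻¹ • standardOp y := by rw [hs, smul_smul, inv_mul_cancel₀ hs0, one_smul]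
  have hsys : system (exampleCoords n q l y) x = 0 := by
    rw [hxs, map_smul, system_standardOp, smul_zero]
  refine isGood_exampleCoords (by omega) htest hone ((system_eq_zero_iff _ _).1 hsys).1
    (inv_ne_zero hs0) fun k => ?_
  rw [hxs]
  rfl

end Existence

end SecantRNC

/-! ### Generic non-existence -/

namespace SecantRNC

section Nonexistence

open Matrix Polynomial

variable {n q l : ℕ}

/-- The pencil of the `j`-th linear space defines a projection to `ℙ¹`; this is the determinant of
the images of the points `i` and `k`. -/
def bracket (c : CoordIndex n (q + 1) l → ℂ) (j : Fin l) (i k : Fin (q + 1)) : ℂ :=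
  (eqn c j 0 ⬝ᵥ pt c i) * (eqn c j 1 ⬝ᵥ pt c k) - (eqn c j 0 ⬝ᵥ pt c k) * (eqn c j 1 ⬝ᵥ pt c i)

/-- This vanishes if and only if the projections from the linear spaces `j` and `j'` map the first
point and the points `i.succ` to quadruples with the same cross ratio (up to degenerate cases). -/
def crossRatioTest (c : CoordIndex n (q + 1) l → ℂ) (j j' : Fin l) (i : Fin 3 → Fin q) : ℂ :=
  bracket c j 0 (i 0).succ * bracket c j (i 1).succ (i 2).succ *
      (bracket c j' 0 (i 1).succ * bracket c j' (i 0).succ (i 2).succ) -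
    bracket c j 0 (i 1).succ * bracket c j (i 0).succ (i 2).succ *
      (bracket c j' 0 (i 0).succ * bracket c j' (i 1).succ (i 2).succ)

lemma isPolyFun_bracket (j : Fin l) (i k : Fin (q + 1)) :
    IsPolyFun (fun c : CoordIndex n (q + 1) l → ℂ => bracket c j i k) :=
  have h : ∀ k' i', IsPolyFun (fun c : CoordIndex n (q + 1) l → ℂ => eqn c j k' ⬝ᵥ pt c i') :=
    fun k' i' => isPolyFun_dotProduct (isPolyFun_eqn j k') (isPolyFun_pt i')
  ((h 0 i).mul (h 1 k)).sub ((h 0 k).mul (h 1 i))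

lemma isPolyFun_crossRatioTest (j j' : Fin l) (i : Fin 3 → Fin q) :
    IsPolyFun (fun c : CoordIndex n (q + 1) l → ℂ => crossRatioTest c j j' i) :=
  have h := fun j i k => isPolyFun_bracket (n := n) (q := q) (l := l) j i k
  (((h _ _ _).mul (h _ _ _)).mul ((h _ _ _).mul (h _ _ _))).sub
    (((h _ _ _).mul (h _ _ _)).mul ((h _ _ _).mul (h _ _ _)))

/-- If the curve exists, the projection from each linear space restricts to an isomorphism from the
curve to `ℙ¹`. So the brackets are, up to scaling, those of the parameters of the points. -/
lemma IsOperator.exists_mul_bracket {c : CoordIndex n (q + 1) l → ℂ} {x : Unknown n q l → ℂ}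
    (hx : IsOperator c x) {φ : Fin (n + 1) → ℂ[X]} (hφ : IsParam φ)
    (hT : ∀ k, pull φ (opForms x k) = X * pull φ (formsAt (pt c 0) k))
    (hP : pt c 0 (Fin.last n) ≠ 0) {j : Fin l} (he : LinearIndependent ℂ (eqn c j))
    (hj : ¬ ∀ k, eqn c j k ⬝ᵥ pt c 0 = 0) :
    ∃ (N : ℂ) (μ : Fin q → ℂ), N ≠ 0 ∧ (∀ i, bracket c j 0 i.succ = -μ i) ∧ ∀ i k,
      N * bracket c j i.succ k.succ =
        pt c 0 (Fin.last n) * (μ i * μ k * (param x k - param x i)) := by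
  set P := pt c 0 with hPdef
  set e := eqn c j with hedef
  set y := fun k => x (Sum.inr (Sum.inl (j, k))) with hy
  have hμ0 : pull φ (memberAt P e) ≠ 0 := fun h =>
    memberAt_ne_zero he hj (hφ.pull_eq_zero_iff.1 h)
  have hY : opMember c x j = y 0 • e 0 + y 1 • e 1 := rfl
  have hpull := hx.pull_opMember hT j
  -- Otherwise the image of the member of the pencil is proportional to it.
  have hN : y 0 * (e 0 ⬝ᵥ P) + y 1 * (e 1 ⬝ᵥ P) ≠ 0 := by
    intro h
    have key : ∀ s r : ℂ, s • opMember c x j = r • memberAt P e → s = 0 := by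
      intro s r hsr
      have h1 := congrArg (pull φ) hsr
      rw [map_smul, map_smul, hpull, smul_eq_C_mul, smul_eq_C_mul] at h1
      have h2 : (C (s * P (Fin.last n)) * X - C r) * pull φ (memberAt P e) = 0 := by
        rw [C_mul]
        linear_combination h1
      have h3 := congrArg (fun f => coeff f 1) ((mul_eq_zero.1 h2).resolve_right hμ0)
      simp only [coeff_sub, coeff_C_mul, coeff_X_one, coeff_C_succ, mul_one, sub_zero,
        coeff_zero] at h3
      exact (mul_eq_zero.1 h3).resolve_right hP
    refine hj (Fin.forall_fin_two.2 ⟨key _ (-y 1) ?_, key _ (y 0) ?_⟩)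
    · funext m
      simp only [hY, memberAt, Pi.smul_apply, Pi.add_apply, smul_eq_mul]
      linear_combination e 0 m * h
    · funext m
      simp only [hY, memberAt, Pi.smul_apply, Pi.add_apply, smul_eq_mul]
      linear_combination e 1 m * h
  have hval : ∀ i : Fin q, y 0 * (e 0 ⬝ᵥ pt c i.succ) + y 1 * (e 1 ⬝ᵥ pt c i.succ) =
      P (Fin.last n) * (param x i * (memberAt P e ⬝ᵥ pt c i.succ)) := by
    intro i
    have h1 := congrArg (· ⬝ᵥ pt c i.succ) (hx.space j)
    have h2 := congrArg (· ⬝ᵥ pt c i.succ) (sum_smul_formsAt (memberAt_dotProduct_self P e))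
    simp only [hY, sum_dotProduct, add_dotProduct, smul_dotProduct, smul_eq_mul, hx.point]
      at h1 h2
    rw [← h1, mul_left_comm, ← h2, Finset.mul_sum]
    exact Finset.sum_congr rfl fun k _ => mul_left_comm _ _ _
  have hμ : ∀ i : Fin q, memberAt P e ⬝ᵥ pt c i.succ =
      (e 1 ⬝ᵥ P) * (e 0 ⬝ᵥ pt c i.succ) - (e 0 ⬝ᵥ P) * (e 1 ⬝ᵥ pt c i.succ) := by
    intro i
    simp only [memberAt, add_dotProduct, smul_dotProduct, smul_eq_mul]
    ring
  refine ⟨_, fun i => memberAt P e ⬝ᵥ pt c i.succ, hN, fun i => ?_, fun i k => ?_⟩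
  · simp only [hμ, bracket]
    ring
  · have hi := hval i
    have hk := hval k
    simp only [hμ, bracket] at hi hk ⊢
    linear_combination
      ((e 1 ⬝ᵥ P) * (e 0 ⬝ᵥ pt c i.succ) - (e 0 ⬝ᵥ P) * (e 1 ⬝ᵥ pt c i.succ)) * hk -
      ((e 1 ⬝ᵥ P) * (e 0 ⬝ᵥ pt c k.succ) - (e 0 ⬝ᵥ P) * (e 1 ⬝ᵥ pt c k.succ)) * hi

lemma IsOperator.crossRatioTest_eq_zero {c : CoordIndex n (q + 1) l → ℂ} {x : Unknown n q l → ℂ}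
    (hx : IsOperator c x) {φ : Fin (n + 1) → ℂ[X]} (hφ : IsParam φ)
    (hT : ∀ k, pull φ (opForms x k) = X * pull φ (formsAt (pt c 0) k))
    (hP : pt c 0 (Fin.last n) ≠ 0) (he : ∀ j, LinearIndependent ℂ (eqn c j))
    (hL : ∀ j, ¬ ∀ k, eqn c j k ⬝ᵥ pt c 0 = 0) (j j' : Fin l) (i : Fin 3 → Fin q) :
    crossRatioTest c j j' i = 0 := by
  obtain ⟨N, μ, hN, h0, h⟩ := hx.exists_mul_bracket hφ hT hP (he j) (hL j)
  obtain ⟨N', μ', hN', h0', h'⟩ := hx.exists_mul_bracket hφ hT hP (he j') (hL j')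
  refine (mul_eq_zero.1 ?_).resolve_left (mul_ne_zero hN hN')
  calc N * N' * crossRatioTest c j j' i =
      bracket c j 0 (i 0).succ * (N * bracket c j (i 1).succ (i 2).succ) *
        (bracket c j' 0 (i 1).succ * (N' * bracket c j' (i 0).succ (i 2).succ)) -
      bracket c j 0 (i 1).succ * (N * bracket c j (i 0).succ (i 2).succ) *
        (bracket c j' 0 (i 0).succ * (N' * bracket c j' (i 1).succ (i 2).succ)) := by
        rw [crossRatioTest]
        ring
    _ = 0 := by
      simp only [h, h', h0, h0']
      ring

lemma exists_crossRatioTest_ne_zero (hn : 2 ≤ n) {j j' : Fin l} (hj : j ≠ j') {i : Fin 3 → Fin q}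
    (hi : Function.Injective i) :
    ∃ c : CoordIndex n (q + 1) l → ℂ, crossRatioTest c j j' i ≠ 0 := by
  -- The projections map the four points to `0, 1, 1, 2` and `0, 0, 1, 1`, respectively.
  let t : Fin (q + 1) → ℂ := fun k => if k = 0 then 0 else if k = (i 2).succ then 2 else 1
  let s : Fin (q + 1) → ℂ := fun k => if k = 0 ∨ k = (i 0).succ then 0 else 1
  let z : Fin (q + 1) → Fin (n + 1) → ℂ := fun k =>
    Pi.single ⟨0, by omega⟩ 1 + Pi.single ⟨1, by omega⟩ (t k) + Pi.single ⟨2, by omega⟩ (s k)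
  let e : Fin l → Fin 2 → Fin (n + 1) → ℂ := fun m =>
    ![Pi.single ⟨0, by omega⟩ 1, Pi.single (if m = j then ⟨1, by omega⟩ else ⟨2, by omega⟩) 1]
  let c : CoordIndex n (q + 1) l → ℂ :=
    Sum.elim (fun im => z im.1 im.2) fun jkm => e jkm.1 jkm.2.1 jkm.2.2
  have h0 : ∀ m k, eqn c m 0 ⬝ᵥ pt c k = 1 := by
    intro m k
    change (Pi.single _ 1 : Fin (n + 1) → ℂ) ⬝ᵥ z k = 1
    simp [z]
  have h1 : ∀ k, eqn c j 1 ⬝ᵥ pt c k = t k := by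
    intro k
    change (Pi.single (if j = j then _ else _) 1 : Fin (n + 1) → ℂ) ⬝ᵥ z k = t k
    simp [z]
  have h1' : ∀ k, eqn c j' 1 ⬝ᵥ pt c k = s k := by
    intro k
    change (Pi.single (if j' = j then _ else _) 1 : Fin (n + 1) → ℂ) ⬝ᵥ z k = s k
    simp [z, hj.symm]
  refine ⟨c, ?_⟩
  have h01 : i 0 ≠ i 1 := fun h => by simpa using hi h
  have h02 : i 0 ≠ i 2 := fun h => by simpa using hi h
  have h12 : i 1 ≠ i 2 := fun h => by simpa using hi h
  simp only [crossRatioTest, bracket, h0, h1, h1']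
  simp [t, s, h02, h12, h01.symm, h02.symm, Fin.succ_ne_zero]
  norm_num

theorem generically_not_exists (hn : 3 ≤ n) (hq : 3 ≤ q) (hl : 2 ≤ l) :
    Generically (fun δ : Datum n (q + 1) l => ¬ ∃ S : Set (PSpace n), δ.IsSolution S) := by
  let i : Fin 3 → Fin q := Fin.castLE hq
  let j : Fin 2 → Fin l := Fin.castLE hl
  have hex : ∃ δ : Datum n (q + 1) l, δ.HasCoords (exampleCoords n q l fun _ => 1) := by
    refine exists_hasCoords_exampleCoords fun j h => ?_
    have h1 := congrArg (eval 1) h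
    simp [toPoly, eval_finsetSum] at h1
    omega
  have : NeZero n := ⟨by omega⟩
  set c₀ := exampleCoords n q l fun _ => 1 with hc₀
  obtain ⟨δ, hδ⟩ := hex
  obtain ⟨V, hV, hV₀, hVex⟩ := exists_isPolyFun_hasCoords hδ
  -- The conditions for the linear system to be available and the condition on the cross ratios.
  let ι := Option (Option (Option (Fin q ⊕ Fin l)))
  let F : ι → (CoordIndex n (q + 1) l → ℂ) → ℂ := fun o c =>
    o.elim (V c) fun o => o.elim (crossRatioTest c (j 0) (j 1) i) fun o =>
      o.elim (pt c 0 (Fin.last n)) fun o =>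
        Sum.elim (fun k : Fin q => formsAt (pt c 0) 0 ⬝ᵥ pt c k.succ)
          (fun k : Fin l => eqn c k 0 ⬝ᵥ pt c 0) o
  have hF : ∀ o, IsPolyFun (F o) := by
    rintro (_ | _ | _ | k | k)
    · exact hV
    · exact isPolyFun_crossRatioTest _ _ _
    · exact isPolyFun_pt _ _
    · exact isPolyFun_dotProduct (isPolyFun_formsAt 0) (isPolyFun_pt k.succ)
    · exact isPolyFun_dotProduct (isPolyFun_eqn k 0) (isPolyFun_pt 0)
  have hF₀ : ∀ o, ∃ c, F o c ≠ 0 := by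
    rintro (_ | _ | _ | k | k)
    · exact ⟨c₀, hV₀⟩
    · exact exists_crossRatioTest_ne_zero (by omega)
        (fun h => by simpa using Fin.castLE_injective hl h) (Fin.castLE_injective hq)
    · exact ⟨c₀, by
        change pt c₀ 0 (Fin.last n) ≠ 0
        rw [pt_exampleCoords_zero]
        exact one_ne_zero⟩
    · exact ⟨c₀, formsAt_exampleCoords_ne_zero _ k⟩
    · refine ⟨c₀, ?_⟩
      change eqn c₀ k 0 ⬝ᵥ pt c₀ 0 ≠ 0
      rw [dotProduct_pt_exampleCoords_zero, eqn_exampleCoords_zero, pull_lowForm]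
      simp [toPoly, eval_finsetSum, NeZero.ne n]
  obtain ⟨c, hc⟩ := IsPolyFun.exists_forall_ne_zero (s := Finset.univ) (fun o _ => hF o)
    fun o _ => hF₀ o
  obtain ⟨δ', hδ'⟩ := hVex c (hc none (Finset.mem_univ _))
  refine generically_of_isPolyFun (F := fun c => ∏ o, F o c) (IsPolyFun.prod fun o _ => hF o)
    ⟨δ', c, hδ', Finset.prod_ne_zero_iff.2 hc⟩ ?_
  rintro δ c hδ hne ⟨S, hS⟩
  have h := fun o => Finset.prod_ne_zero_iff.1 hne o (Finset.mem_univ o)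
  have hP : pt c 0 (Fin.last n) ≠ 0 := h (some (some none))
  have hL : ∀ m, ¬ ∀ k, eqn c m k ⬝ᵥ pt c 0 = 0 := fun m hm =>
    h (some (some (some (Sum.inr m)))) (hm 0)
  obtain ⟨φ, x, hφ, -, hx, hT⟩ := exists_isOperator_of_isSolution (by omega) hδ
    (fun k => ⟨0, h (some (some (some (Sum.inl k))))⟩) hL hS
  exact h (some none) (hx.crossRatioTest_eq_zero hφ hT hP (linearIndependent_eqn hδ) hL _ _ _)

end Nonexistence

end SecantRNC

theorem theorem4p7 (n p l : ℕ) (hn : 3 ≤ n) (hp : 1 ≤ p) (hpl : p + l = n + 3) :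
    (Generically (fun δ : Datum n p l => ∃! C : Set (PSpace n), δ.IsSolution C) ↔
      (p, l) = (n + 3, 0) ∨ (p, l) = (n + 2, 1) ∨ (p, l) = (3, n) ∨
        (p, l) = (2, n + 1) ∨ (p, l) = (1, n + 2)) ∧
    (4 ≤ p → 2 ≤ l →
      Generically (fun δ : Datum n p l => ¬ ∃ C : Set (PSpace n), δ.IsSolution C)) := by
  obtain ⟨q, rfl⟩ : ∃ q, p = q + 1 := ⟨p - 1, by omega⟩
  have hnot : 4 ≤ q + 1 → 2 ≤ l → Generically (fun δ : Datum n (q + 1) l =>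
      ¬ ∃ C : Set (PSpace n), δ.IsSolution C) := fun hq hl =>
    SecantRNC.generically_not_exists hn (by omega) hl
  refine ⟨⟨fun h => ?_, fun h => ?_⟩, hnot⟩
  · by_contra hlist
    simp only [Prod.mk.injEq] at hlist
    obtain ⟨δ, hex, hne⟩ := SecantRNC.Generically.exists_and h (hnot (by omega) (by omega))
    exact hne hex.exists
  · simp only [Prod.mk.injEq] at h
    exact SecantRNC.generically_existsUnique (by omega) (by omega) (by omega)
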